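/- Let $A$ be a finite-dimensional Hopf algebra over a field $\Bbbk$, with coproduct $\Delta$, counit $\epsilon$ and antipode $S$. Let $A$-mod be the category of finite-dimensional left $A$-modules, with the tensor product over $\Bbbk$ on which $A$ acts through $\Delta$ and the unit object $\mathbb 1=\Bbbk$ on which $A$ acts through $\epsilon$. For a module $V$ let $V^*=\mathrm{Hom}_\Bbbk(V,\Bbbk)$ with $(a\varphi)(v)=\varphi(S(a)v)$. Suppose that $A$ is *pivotal*: a group-like element $g\in A$ with $S^2(x)=gxg^{-1}$ for all $x\in A$ is given. Then $A$-mod is a pivotal category with the duality morphisms $\overleftarrow{\mathrm{ev}}_V(\varphi\otimes v)=\varphi(v)$, $\overleftarrow{\mathrm{coev}}_V(1)=\sum_i e_i\otimes e^i$, $\overrightarrow{\mathrm{ev}}_V(v\otimes\varphi)=\varphi(gv)$, $\overrightarrow{\mathrm{coev}}_V(1)=\sum_i e^i\otimes g^{-1}e_i$, where $(e_i)$ is a basis of $V$ and $(e^i)$ is the dual basis. Suppose that $A$ is *unimodular*: $S(\Lambda)=\Lambda$ for every left cointegral $\Lambda$ (an element $\Lambda\in A$ with $x\Lambda=\epsilon(x)\Lambda$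 for all $x\in A$). An *ideal* of $A$-mod is a full subcategory closed under retracts and under tensor products with arbitrary objects on either side. A *left* (resp. *right*) *m-trace* on an ideal $\mathcal I$ is a family of linear forms $\mathsf t_V:\mathrm{End}(V)\to\Bbbk$, $V\in\mathcal I$, such that $\mathsf t_V(pq)=\mathsf t_U(qp)$ for all $U,V\in\mathcal I$, $q:V\to U$, $p:U\to V$, and such that, for all $U\in\mathcal I$, all objects $W$ and all $f\in\mathrm{End}(W\otimes U)$ (resp. $f\in\mathrm{End}(U\otimes W)$), $$\mathsf t_{W\otimes U}(f)=\mathsf t_U\big((\overleftarrow{\mathrm{ev}}_W\otimes \mathrm{Id}_U)(\mathrm{Id}_{W^*}\otimes f)(\overrightarrow{\mathrm{coev}}_W\otimes \mathrm{Id}_U)\big)$$ $$\text{(resp. } \mathsf t_{U\otimes W}(f)=\mathsf t_U\big((\mathrm{Id}_U\otimes\overrightarrow{\mathrm{ev}}_W)(f\otimes \mathrm{Id}_{W^*})(\mathrm{Id}_U\otimes\overleftarrow{\mathrm{coev}}_W)\big)\text{)}.$$ An *m-trace* is a left m-trace that is also a right m-trace. It is *non-degenerate* if for every $P\in\mathcal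 I$ the pairing $\mathrm{Hom}(\mathbb 1,P)\times \mathrm{Hom}(P,\mathbb 1)\to\Bbbk$, $(x,y)\mapsto\mathsf t_P(xy)$, is non-degenerate; then $\Lambda_P=\sum_i x_iy_i\in\mathrm{End}(P)$, where $(x_i)$ is a basis of $\mathrm{Hom}(\mathbb 1,P)$ and $(y_i)$ is the dual basis of $\mathrm{Hom}(P,\mathbb 1)$. A *generator* of $\mathcal I$ is an object $G\in\mathcal I$ such that for every $P\in\mathcal I$ the morphism $\mathrm{Id}_P$ is a finite sum $\sum_j f_jg_j$ with $f_j:G\to P$ and $g_j:P\to G$. A *chromatic morphism* for $G\in\mathcal I$ (with respect to a non-degenerate m-trace) is a morphism $\tilde d:G\otimes G\to G\otimes G$ with $$(\mathrm{Id}_G\otimes\overleftarrow{\mathrm{ev}}_G\otimes\mathrm{Id}_G)\circ(\Lambda_{G\otimes G^*}\otimes\tilde d)\circ(\mathrm{Id}_G\otimes\overrightarrow{\mathrm{coev}}_G\otimes\mathrm{Id}_G)=\mathrm{Id}_{G\otimes G}.$$ Let $\mathsf{Proj}$ be the full subcategory of projective objects of $A$-mod, and suppose finally that $A$ (with $g$)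 is *unibalanced*: every left m-trace on $\mathsf{Proj}$ is also a right m-trace. Then: 1. $\mathsf{Proj}$ is an ideal of $A$-mod, and the left regular module $A$ is a generator of $\mathsf{Proj}$. 2. There are a right integral $\lambda$ of $A$ (a linear form $\lambda:A\to\Bbbk$ with $(\lambda\otimes\mathrm{Id}_A)\Delta(x)=\lambda(x)1_A$ for all $x\in A$) and a left cointegral $\Lambda\in A$ such that $\lambda(\Lambda)=1$. 3. Let $\lambda,\Lambda$ be any such pair, and let $f_\Lambda:\mathbb 1\to A$ be the morphism carrying $1$ to $\Lambda$. There is a non-degenerate m-trace $\mathsf t$ on $\mathsf{Proj}$ with $\mathsf t_A(f_\Lambda\circ\epsilon)=1$. 4. With respect to every $\mathsf t$ as in 3, the morphism $$\tilde d=(\overrightarrow{\mathrm{ev}}_A\otimes\mathrm{Id}_{A\otimes A})\circ(\mathrm{Id}_A\otimes f_{\lambda}\otimes\mathrm{Id}_A)\circ(\mathrm{Id}_A\otimes\Delta):A\otimes A\to A\otimes A,$$ where $f_{\lambda}:A\to A^*\otimes A$ is the morphism of $A$-modules carrying $1_A$ to $\lambda\otimes 1_A$, is a chromatic morphism for $A$.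 -/

import Mathlib

open CategoryTheory MonoidalCategory TensorProduct

universe w v u

/-! ### Pivotal categories, ideals, modified traces, generators, chromatic morphisms -/

section General

variable {C : Type u} [Category.{v} C] [MonoidalCategory C]

/-- The morphism `X ⟶ D` obtained from `b : X ⊗ V ⟶ 𝟙_ C` with the help of `c : 𝟙_ C ⟶ V ⊗ D`. -/
def leftMate {X V D : C} (c : 𝟙_ C ⟶ V ⊗ D) (b : X ⊗ V ⟶ 𝟙_ C) : X ⟶ D :=
  (ρ_ X).inv ≫ X ◁ c ≫ (α_ X V D).inv ≫ b ▷ D ≫ (λ_ D).hom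

/-- The morphism `X ⟶ D` obtained from `b : V ⊗ X ⟶ 𝟙_ C` with the help of `c : 𝟙_ C ⟶ D ⊗ V`. -/
def rightMate {X V D : C} (c : 𝟙_ C ⟶ D ⊗ V) (b : V ⊗ X ⟶ 𝟙_ C) : X ⟶ D :=
  (λ_ X).inv ≫ c ▷ X ≫ (α_ D V X).hom ≫ D ◁ b ≫ (ρ_ D).hom

/-- The nested pairing `(Y ⊗ X) ⊗ (V ⊗ W) ⟶ 𝟙_ C` of two pairings `X ⊗ V ⟶ 𝟙_ C` and
`Y ⊗ W ⟶ 𝟙_ C`. -/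
def nestedPairing {X Y V W : C} (b : X ⊗ V ⟶ 𝟙_ C) (c : Y ⊗ W ⟶ 𝟙_ C) :
    (Y ⊗ X) ⊗ (V ⊗ W) ⟶ 𝟙_ C :=
  (α_ Y X (V ⊗ W)).hom ≫ Y ◁ ((α_ X V W).inv ≫ b ▷ W ≫ (λ_ W).hom) ≫ c

variable (C) in
/-- A pivotal structure on a monoidal category: every object has a dual, which is a left and a right
dual by means of the morphisms `coevL`, `evL` (written with arrows pointing to the left) and
`coevR`, `evR` (arrows pointing to the right), and the resulting left and right duality functors
coincide as monoidal functors. -/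
structure PivotalStructure where
  dual : C → C
  coevL (V : C) : 𝟙_ C ⟶ V ⊗ dual V
  evL (V : C) : dual V ⊗ V ⟶ 𝟙_ C
  coevR (V : C) : 𝟙_ C ⟶ dual V ⊗ V
  evR (V : C) : V ⊗ dual V ⟶ 𝟙_ C
  coevL_evL (V : C) :
    dual V ◁ coevL V ≫ (α_ _ _ _).inv ≫ evL V ▷ dual V = (ρ_ (dual V)).hom ≫ (λ_ (dual V)).inv
  evL_coevL (V : C) :
    coevL V ▷ V ≫ (α_ _ _ _).hom ≫ V ◁ evL V = (λ_ V).hom ≫ (ρ_ V).inv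
  coevR_evR (V : C) :
    V ◁ coevR V ≫ (α_ _ _ _).inv ≫ evR V ▷ V = (ρ_ V).hom ≫ (λ_ V).inv
  evR_coevR (V : C) :
    coevR V ▷ dual V ≫ (α_ _ _ _).hom ≫ dual V ◁ evR V = (λ_ (dual V)).hom ≫ (ρ_ (dual V)).inv
  transpose_eq {V W : C} (f : V ⟶ W) :
    leftMate (coevL V) (dual W ◁ f ≫ evL W) = rightMate (coevR V) (f ▷ dual W ≫ evR W)
  tensor_eq (V W : C) :
    leftMate (coevL (V ⊗ W)) (nestedPairing (evL V) (evL W)) =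
      rightMate (coevR (V ⊗ W)) (nestedPairing (evR W) (evR V))

/-- A full subcategory (given by its objects) is an ideal if it is closed under tensor products with
arbitrary objects on both sides and under retracts. -/
structure IsTensorIdeal (I : ObjectProperty C) : Prop where
  tensor_right (V W : C) : I V → I (V ⊗ W)
  tensor_left (V W : C) : I V → I (W ⊗ V)
  retract (V W : C) (f : W ⟶ V) (g : V ⟶ W) : f ≫ g = 𝟙 W → I V → I W

/-- The partial trace over `W` (on the right) of an endomorphism of `U ⊗ W`. -/
def rightPartialTrace (D : PivotalStructure C) {U W : C} (f : U ⊗ W ⟶ U ⊗ W) : U ⟶ U :=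
  (ρ_ U).inv ≫ U ◁ D.coevL W ≫ (α_ U W (D.dual W)).inv ≫ f ▷ D.dual W ≫
    (α_ U W (D.dual W)).hom ≫ U ◁ D.evR W ≫ (ρ_ U).hom

/-- The partial trace over `W` (on the left) of an endomorphism of `W ⊗ U`. -/
def leftPartialTrace (D : PivotalStructure C) {U W : C} (f : W ⊗ U ⟶ W ⊗ U) : U ⟶ U :=
  (λ_ U).inv ≫ D.coevR W ▷ U ≫ (α_ (D.dual W) W U).hom ≫ D.dual W ◁ f ≫
    (α_ (D.dual W) W U).inv ≫ D.evL W ▷ U ≫ (λ_ U).hom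

variable (k : Type w) [Field k] [Preadditive C] [Linear k C]

/-- A family of linear forms on `End V`, for the objects `V` of `I`. -/
abbrev TraceFamily (I : ObjectProperty C) : Type _ :=
  ∀ V : C, I V → ((V ⟶ V) →ₗ[k] k)

variable {k} {I : ObjectProperty C}

def TraceFamily.IsCyclic (t : TraceFamily k I) : Prop :=
  ∀ (U V : C) (hU : I U) (hV : I V) (f : V ⟶ U) (g : U ⟶ V), t V hV (f ≫ g) = t U hU (g ≫ f)

/-- A left modified trace on `I`. The membership of `W ⊗ U` in `I` is automatic
if `I` is an ideal. -/
structure TraceFamily.IsLeftMTrace (t : TraceFamily k I) (D : PivotalStructure C) : Prop where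
  cyclic : t.IsCyclic
  left_partial (U W : C) (hU : I U) (hWU : I (W ⊗ U)) (f : W ⊗ U ⟶ W ⊗ U) :
    t (W ⊗ U) hWU f = t U hU (leftPartialTrace D f)

/-- A right modified trace on `I`. The membership of `U ⊗ W` in `I` is automatic
if `I` is an ideal. -/
structure TraceFamily.IsRightMTrace (t : TraceFamily k I) (D : PivotalStructure C) : Prop where
  cyclic : t.IsCyclic
  right_partial (U W : C) (hU : I U) (hUW : I (U ⊗ W)) (f : U ⊗ W ⟶ U ⊗ W) :
    t (U ⊗ W) hUW f = t U hU (rightPartialTrace D f)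

/-- A (two-sided) modified trace: cyclicity and both partial trace properties. -/
def TraceFamily.IsMTrace (t : TraceFamily k I) (D : PivotalStructure C) : Prop :=
  t.IsLeftMTrace D ∧ t.IsRightMTrace D

/-- For all `P` in `I`, the pairing `Hom(𝟙, P) × Hom(P, 𝟙) → k`, `(x, y) ↦ t_P (x ∘ y)`, is
non-degenerate (on both sides). -/
def TraceFamily.IsNondegenerate (t : TraceFamily k I) : Prop :=
  ∀ (P : C) (hP : I P),
    (∀ x : 𝟙_ C ⟶ P, (∀ y : P ⟶ 𝟙_ C, t P hP (y ≫ x) = 0) → x = 0) ∧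
    (∀ y : P ⟶ 𝟙_ C, (∀ x : 𝟙_ C ⟶ P, t P hP (y ≫ x) = 0) → y = 0)

/-- `L = ∑ x_i ∘ y_i`, where `(x_i)` is a basis of `Hom(𝟙, P)` and `(y_i)` is the basis of
`Hom(P, 𝟙)` dual to it with respect to the pairing `(x, y) ↦ t_P (x ∘ y)`. There is at most one such
`L`, since `∑ x_i ⊗ y_i` does not depend on the choice of the basis. -/
def TraceFamily.IsDualBasisSum (t : TraceFamily k I) (P : C) (hP : I P) (L : P ⟶ P) : Prop :=
  ∃ (n : ℕ) (x : Module.Basis (Fin n) k (𝟙_ C ⟶ P)) (y : Module.Basis (Fin n) k (P ⟶ 𝟙_ C)),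
    (∀ i j, t P hP (y j ≫ x i) = if i = j then 1 else 0) ∧ L = ∑ i, y i ≫ x i

/-- `G` is a generator of `I`: it lies in `I` and every identity morphism in `I` is a finite sum of
endomorphisms that factor through `G`. -/
def IsIdealGenerator (I : ObjectProperty C) (G : C) : Prop :=
  I G ∧ ∀ P : C, I P → ∃ (n : ℕ) (f : Fin n → (G ⟶ P)) (g : Fin n → (P ⟶ G)),
    𝟙 P = ∑ j, g j ≫ f j

/-- The morphism `(Id_G ⊗ evL_G ⊗ Id_G) ∘ (L ⊗ d) ∘ (Id_G ⊗ coevR_G ⊗ Id_G)`. -/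
def chromaticComposite (D : PivotalStructure C) {G : C} (L : G ⊗ D.dual G ⟶ G ⊗ D.dual G)
    (d : G ⊗ G ⟶ G ⊗ G) : G ⊗ G ⟶ G ⊗ G :=
  G ◁ ((λ_ G).inv ≫ D.coevR G ▷ G ≫ (α_ (D.dual G) G G).hom) ≫ (α_ G (D.dual G) (G ⊗ G)).inv ≫
    (L ⊗ₘ d) ≫
    (α_ G (D.dual G) (G ⊗ G)).hom ≫ G ◁ ((α_ (D.dual G) G G).inv ≫ D.evL G ▷ G ≫ (λ_ G).hom)

/-- `d` is a chromatic morphism for the object `G` of `I`, with respect to the modified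
trace `t`. -/
def TraceFamily.IsChromatic (t : TraceFamily k I) (D : PivotalStructure C) {G : C}
    (d : G ⊗ G ⟶ G ⊗ G) : Prop :=
  I G ∧ ∃ (h : I (G ⊗ D.dual G)) (L : G ⊗ D.dual G ⟶ G ⊗ D.dual G),
    t.IsDualBasisSum (G ⊗ D.dual G) h L ∧ chromaticComposite D L d = 𝟙 (G ⊗ G)

end General

/-! ### The category of finite-dimensional modules over a Hopf algebra -/

section Modules

/-- A finite-dimensional left module over the `k`-algebra `A`: a finite-dimensional vector space
with an algebra morphism from `A` to its endomorphisms. -/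
structure FDMod (k A : Type u) [Field k] [Ring A] [Algebra k A] where
  V : Type u
  [addCommGroup : AddCommGroup V]
  [module : Module k V]
  [finite : Module.Finite k V]
  ρ : A →ₐ[k] Module.End k V

namespace FDMod

variable {k A : Type u} [Field k] [Ring A]

attribute [instance] FDMod.addCommGroup FDMod.module FDMod.finite

section Algebra

variable [Algebra k A]

/-- `A`-linear maps. -/
@[ext]
structure Hom (M N : FDMod k A) where
  hom : M.V →ₗ[k] N.V
  comm : ∀ a : A, hom ∘ₗ M.ρ a = N.ρ a ∘ₗ hom

instance : Category (FDMod k A) where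
  Hom M N := Hom M N
  id M := ⟨LinearMap.id, fun _ => rfl⟩
  comp f g := ⟨g.hom ∘ₗ f.hom, fun a => by
    rw [LinearMap.comp_assoc, f.comm, ← LinearMap.comp_assoc, g.comm, LinearMap.comp_assoc]⟩

@[ext]
theorem hom_ext {M N : FDMod k A} {f g : M ⟶ N} (h : f.hom = g.hom) : f = g :=
  Hom.ext h

@[simp]
theorem id_hom (M : FDMod k A) : Hom.hom (𝟙 M) = LinearMap.id := rfl

@[simp]
theorem comp_hom {M N P : FDMod k A} (f : M ⟶ N) (g : N ⟶ P) :
    Hom.hom (f ≫ g) = g.hom ∘ₗ f.hom := rfl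

variable {M N : FDMod k A}

instance : Zero (M ⟶ N) := ⟨⟨0, fun a => by simp⟩⟩
instance : Add (M ⟶ N) :=
  ⟨fun f g => ⟨f.hom + g.hom, fun a => by
    rw [LinearMap.add_comp, LinearMap.comp_add, f.comm, g.comm]⟩⟩
instance : Neg (M ⟶ N) :=
  ⟨fun f => ⟨-f.hom, fun a => by rw [LinearMap.neg_comp, LinearMap.comp_neg, f.comm]⟩⟩
instance : Sub (M ⟶ N) :=
  ⟨fun f g => ⟨f.hom - g.hom, fun a => by
    rw [LinearMap.sub_comp, LinearMap.comp_sub, f.comm, g.comm]⟩⟩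
instance {S : Type*} [Monoid S] [DistribMulAction S N.V] [SMulCommClass k S N.V]
    [LinearMap.CompatibleSMul N.V N.V S k] : SMul S (M ⟶ N) :=
  ⟨fun c f => ⟨c • f.hom, fun a => by
    rw [LinearMap.smul_comp, LinearMap.comp_smul, f.comm]⟩⟩

theorem hom_injective : Function.Injective (fun f : M ⟶ N => f.hom) := fun _ _ h => hom_ext h

instance : AddCommGroup (M ⟶ N) :=
  hom_injective.addCommGroup (fun f : M ⟶ N => f.hom) rfl (fun _ _ => rfl) (fun _ => rfl)
    (fun _ _ => rfl) (fun _ _ => rfl) (fun _ _ => rfl)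

@[simp]
theorem add_hom (f g : M ⟶ N) : Hom.hom (f + g) = f.hom + g.hom := rfl

@[simp]
theorem smul_hom (c : k) (f : M ⟶ N) : Hom.hom (c • f) = c • f.hom := rfl

instance : Module k (M ⟶ N) :=
  hom_injective.module k ⟨⟨fun f : M ⟶ N => f.hom, rfl⟩, fun _ _ => rfl⟩ (fun _ _ => rfl)

instance : Preadditive (FDMod k A) where
  add_comp _ _ _ _ _ _ := hom_ext (LinearMap.comp_add _ _ _)
  comp_add _ _ _ _ _ _ := hom_ext (LinearMap.add_comp _ _ _)

instance : Linear k (FDMod k A) where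
  smul_comp _ _ _ _ _ _ := hom_ext (LinearMap.comp_smul _ _ _)
  comp_smul _ _ _ _ _ _ := hom_ext (LinearMap.smul_comp _ _ _)

/-- The left regular module. -/
abbrev regular (k A : Type u) [Field k] [Ring A] [Algebra k A] [Module.Finite k A] : FDMod k A where
  V := A
  ρ := Algebra.lmul k A

/-- The morphism from the regular module to `M` that carries `1` to `m`. -/
def ofElem [Module.Finite k A] (M : FDMod k A) (m : M.V) : regular k A ⟶ M where
  hom := LinearMap.applyₗ m ∘ₗ M.ρ.toLinearMap
  comm a := by
    refine LinearMap.ext fun (b : A) => ?_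
    change M.ρ (a * b) m = M.ρ a (M.ρ b m)
    rw [map_mul]
    rfl

end Algebra

section Bialgebra

variable [Bialgebra k A]

/-- The tensor product over `k`, on which `A` acts through the coproduct. -/
abbrev tensor (M N : FDMod k A) : FDMod k A where
  V := M.V ⊗[k] N.V
  ρ := (Module.endTensorEndAlgHom (R := k) (S := k) (A := k) (M := M.V) (N := N.V)).comp
    ((Algebra.TensorProduct.map M.ρ N.ρ).comp (Bialgebra.comulAlgHom k A))

variable (k A) in
/-- The ground field, on which `A` acts through the counit. -/
abbrev triv : FDMod k A where
  V := k
  ρ := (Algebra.lmul k k).comp (Bialgebra.counitAlgHom k A)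

theorem triv_ρ (a : A) (c : k) : (triv k A).ρ a c = Coalgebra.counit (R := k) a * c := rfl

/-- The linear map `a ↦ a • m`. -/
def orb (M : FDMod k A) (m : M.V) : A →ₗ[k] M.V := LinearMap.applyₗ m ∘ₗ M.ρ.toLinearMap

theorem orb_apply (M : FDMod k A) (m : M.V) (a : A) : M.orb m a = M.ρ a m := rfl

theorem tensor_ρ_tmul (M N : FDMod k A) (a : A) (m : M.V) (n : N.V) :
    (tensor M N).ρ a (m ⊗ₜ[k] n) =
      TensorProduct.map (M.orb m) (N.orb n) (Coalgebra.comul (R := k) a) := by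
  change Module.endTensorEndAlgHom (Algebra.TensorProduct.map M.ρ N.ρ (Coalgebra.comul a))
    (m ⊗ₜ[k] n) = _
  induction Coalgebra.comul (R := k) a with
  | zero => simp
  | add x y hx hy => rw [map_add, map_add, map_add, LinearMap.add_apply, hx, hy]
  | tmul x y => rfl

theorem hom_ρ {M N : FDMod k A} (f : M ⟶ N) (a : A) (m : M.V) :
    f.hom (M.ρ a m) = N.ρ a (f.hom m) := LinearMap.congr_fun (f.comm a) m

/-- The tensor product of two morphisms. -/
def tensorMap {M N M' N' : FDMod k A} (f : M ⟶ N) (g : M' ⟶ N') : tensor M M' ⟶ tensor N N' where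
  hom := TensorProduct.map f.hom g.hom
  comm a := by
    refine TensorProduct.ext' fun x y => ?_
    change TensorProduct.map f.hom g.hom ((tensor M M').ρ a (x ⊗ₜ[k] y)) =
      (tensor N N').ρ a (f.hom x ⊗ₜ[k] g.hom y)
    rw [tensor_ρ_tmul, tensor_ρ_tmul]
    induction Coalgebra.comul (R := k) a with
    | zero => simp
    | add x y hx hy => rw [map_add, map_add, map_add, hx, hy]
    | tmul x y => simp [orb_apply, hom_ρ]

/-- An invertible `A`-linear map is an isomorphism. -/
def mkIso {M N : FDMod k A} (e : M.V ≃ₗ[k] N.V)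
    (h : ∀ a : A, e.toLinearMap ∘ₗ M.ρ a = N.ρ a ∘ₗ e.toLinearMap) : M ≅ N where
  hom := ⟨e.toLinearMap, h⟩
  inv := ⟨e.symm.toLinearMap, fun a => by
    refine LinearMap.ext fun x => e.injective ?_
    have := LinearMap.congr_fun (h a) (e.symm x)
    simp at this
    simp [this]⟩
  hom_inv_id := hom_ext (LinearMap.ext fun x => e.symm_apply_apply x)
  inv_hom_id := hom_ext (LinearMap.ext fun x => e.apply_symm_apply x)

theorem assoc_act (M N P : FDMod k A) (a : A) :
    (TensorProduct.assoc k M.V N.V P.V).toLinearMap ∘ₗ (tensor (tensor M N) P).ρ a =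
      (tensor M (tensor N P)).ρ a ∘ₗ (TensorProduct.assoc k M.V N.V P.V).toLinearMap := by
  refine TensorProduct.ext_threefold fun m n p => ?_
  let T : A ⊗[k] (A ⊗[k] A) →ₗ[k] M.V ⊗[k] (N.V ⊗[k] P.V) :=
    TensorProduct.map (M.orb m) (TensorProduct.map (N.orb n) (P.orb p))
  have h₁ : ∀ z : A ⊗[k] A, TensorProduct.assoc k M.V N.V P.V
      (TensorProduct.map ((tensor M N).orb (m ⊗ₜ[k] n)) (P.orb p) z) =
      T (TensorProduct.assoc k A A A (Coalgebra.comul.rTensor A z)) := by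
    intro z
    induction z with
    | zero => simp
    | add x y hx hy => simp only [map_add]; rw [← hx, ← hy]
    | tmul x y =>
      change TensorProduct.assoc k M.V N.V P.V
        ((show M.V ⊗[k] N.V from (tensor M N).ρ x (m ⊗ₜ[k] n)) ⊗ₜ[k] P.ρ y p) = _
      rw [tensor_ρ_tmul, LinearMap.rTensor_tmul]
      induction Coalgebra.comul (R := k) x with
      | zero => simp
      | add u v hu hv => simp only [map_add, TensorProduct.add_tmul]; rw [hu, hv]
      | tmul u v => rfl
  have h₂ : ∀ z : A ⊗[k] A,
      TensorProduct.map (M.orb m) ((tensor N P).orb (n ⊗ₜ[k] p)) z =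
      T (Coalgebra.comul.lTensor A z) := by
    intro z
    induction z with
    | zero => simp
    | add x y hx hy => simp only [map_add]; rw [← hx, ← hy]
    | tmul x y =>
      change M.ρ x m ⊗ₜ[k] (show N.V ⊗[k] P.V from (tensor N P).ρ y (n ⊗ₜ[k] p)) = _
      rw [tensor_ρ_tmul]
      rfl
  exact (congrArg (TensorProduct.assoc k M.V N.V P.V)
      (tensor_ρ_tmul (tensor M N) P a (m ⊗ₜ[k] n) p)).trans ((h₁ _).trans
    ((congrArg T (Coalgebra.coassoc_apply a)).trans ((h₂ _).symm.trans
      (tensor_ρ_tmul M (tensor N P) a m (n ⊗ₜ[k] p)).symm)))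

theorem lid_act (M : FDMod k A) (a : A) :
    (TensorProduct.lid k M.V).toLinearMap ∘ₗ (tensor (triv k A) M).ρ a =
      M.ρ a ∘ₗ (TensorProduct.lid k M.V).toLinearMap := by
  refine TensorProduct.ext' fun (c : k) m => ?_
  change TensorProduct.lid k M.V ((tensor (triv k A) M).ρ a (c ⊗ₜ[k] m)) = M.ρ a (c • m)
  rw [tensor_ρ_tmul]
  have h : ∀ z : A ⊗[k] A, TensorProduct.lid k M.V
      (TensorProduct.map ((triv k A).orb c) (M.orb m) z) =
      c • M.orb m (TensorProduct.lid k A (Coalgebra.counit.rTensor A z)) := by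
    intro z
    induction z with
    | zero => simp
    | add x y hx hy => simp only [map_add, smul_add]; rw [← hx, ← hy]
    | tmul x y =>
      change (Coalgebra.counit (R := k) x * c) • M.ρ y m = _
      simp [orb_apply, mul_smul, smul_comm c]
  refine (h _).trans ?_
  simp [orb_apply]

theorem rid_act (M : FDMod k A) (a : A) :
    (TensorProduct.rid k M.V).toLinearMap ∘ₗ (tensor M (triv k A)).ρ a =
      M.ρ a ∘ₗ (TensorProduct.rid k M.V).toLinearMap := by
  refine TensorProduct.ext' fun m (c : k) => ?_
  change TensorProduct.rid k M.V ((tensor M (triv k A)).ρ a (m ⊗ₜ[k] c)) = M.ρ a (c • m)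
  rw [tensor_ρ_tmul]
  have h : ∀ z : A ⊗[k] A, TensorProduct.rid k M.V
      (TensorProduct.map (M.orb m) ((triv k A).orb c) z) =
      c • M.orb m (TensorProduct.rid k A (Coalgebra.counit.lTensor A z)) := by
    intro z
    induction z with
    | zero => simp
    | add x y hx hy => simp only [map_add, smul_add]; rw [← hx, ← hy]
    | tmul x y =>
      change (Coalgebra.counit (R := k) y * c) • M.ρ x m = _
      simp [orb_apply, mul_smul, smul_comm c]
  refine (h _).trans ?_
  simp [orb_apply]

instance : MonoidalCategoryStruct (FDMod k A) where
  tensorObj := tensor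
  whiskerLeft M _ _ f := tensorMap (𝟙 M) f
  whiskerRight f M := tensorMap f (𝟙 M)
  tensorHom := tensorMap
  tensorUnit := triv k A
  associator M N P := mkIso (TensorProduct.assoc k M.V N.V P.V) (assoc_act M N P)
  leftUnitor M := mkIso (TensorProduct.lid k M.V) (lid_act M)
  rightUnitor M := mkIso (TensorProduct.rid k M.V) (rid_act M)

instance : MonoidalCategory (FDMod k A) :=
  MonoidalCategory.ofTensorHom
    (id_tensorHom_id := fun _ _ => hom_ext TensorProduct.map_id)
    (id_tensorHom := fun _ _ _ _ => rfl)
    (tensorHom_id := fun _ _ => rfl)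
    (tensorHom_comp_tensorHom := fun _ _ _ _ => hom_ext (TensorProduct.map_comp _ _ _ _).symm)
    (associator_naturality := fun _ _ _ =>
      hom_ext (TensorProduct.ext_threefold fun _ _ _ => rfl))
    (leftUnitor_naturality := fun f => hom_ext (TensorProduct.ext' fun (c : k) x =>
      (map_smul f.hom c x).symm))
    (rightUnitor_naturality := fun f => hom_ext (TensorProduct.ext' fun x (c : k) =>
      (map_smul f.hom c x).symm))
    (pentagon := fun _ _ _ _ => hom_ext (TensorProduct.ext_fourfold fun _ _ _ _ => rfl))
    (triangle := fun _ _ => hom_ext (TensorProduct.ext_threefold fun x (c : k) y =>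
      (TensorProduct.smul_tmul c x y).symm))

end Bialgebra

section Hopf

variable [HopfAlgebra k A]

/-- The dual space, on which `a` acts by the transpose of the action of `S(a)`. -/
abbrev dual (M : FDMod k A) : FDMod k A where
  V := Module.Dual k M.V
  ρ := AlgHom.ofLinearMap
    (Module.Dual.transpose (R := k) (M := M.V) (M' := M.V) ∘ₗ M.ρ.toLinearMap ∘ₗ
      HopfAlgebra.antipode k)
    (by
      refine LinearMap.ext fun φ => LinearMap.ext fun x => ?_
      simp [Module.Dual.transpose_apply])
    (fun a b => by
      refine LinearMap.ext fun φ => LinearMap.ext fun x => ?_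
      simp [Module.Dual.transpose_apply, HopfAlgebra.antipode_mul_antidistrib])

theorem dual_ρ (M : FDMod k A) (a : A) (φ : Module.Dual k M.V) (x : M.V) :
    (dual M).ρ a φ x = φ (M.ρ (HopfAlgebra.antipode k a) x) := rfl

end Hopf

end FDMod

/-- A pivot of a Hopf algebra: a group-like element `g` such that `S²(x) = g x g⁻¹` for all `x`. -/
structure Pivot (k A : Type u) [Field k] [Ring A] [HopfAlgebra k A] where
  val : Aˣ
  isGroupLike : IsGroupLikeElem k (val : A)
  antipode_antipode (x : A) :
    HopfAlgebra.antipode k (HopfAlgebra.antipode k x) = (val : A) * x * ((val⁻¹ : Aˣ) : A)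

namespace FDMod

noncomputable section Pivotal

variable {k A : Type u} [Field k] [Ring A] [HopfAlgebra k A]

open Coalgebra HopfAlgebra

theorem tensor_ρ_repr (M N : FDMod k A) (a : A) (m : M.V) (n : N.V) :
    (tensor M N).ρ a (m ⊗ₜ[k] n) = ∑ i ∈ (ℛ k a).index,
      M.ρ ((ℛ k a).left i) m ⊗ₜ[k] N.ρ ((ℛ k a).right i) n := by
  rw [tensor_ρ_tmul, ← (ℛ k a).eq, map_sum]
  rfl

/-- `φ ⊗ x ↦ φ(x)` -/
def evL (M : FDMod k A) : tensor (dual M) M ⟶ triv k A where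
  hom := contractLeft k M.V
  comm a := by
    refine TensorProduct.ext' fun φ x => ?_
    change contractLeft k M.V ((tensor (dual M) M).ρ a (φ ⊗ₜ[k] x)) = counit (R := k) a * φ x
    rw [tensor_ρ_repr, map_sum]
    have h := congrArg (fun b => φ (M.ρ b x)) (sum_antipode_mul_eq_smul (ℛ k a))
    simpa [Module.Dual.transpose_apply] using h

/-- `x ⊗ φ ↦ φ(g x)` -/
def evR (g : Pivot k A) (M : FDMod k A) : tensor M (dual M) ⟶ triv k A where
  hom := contractRight k M.V ∘ₗ TensorProduct.map (M.ρ (g.val : A)) LinearMap.id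
  comm a := by
    refine TensorProduct.ext' fun x φ => ?_
    change (contractRight k M.V ∘ₗ TensorProduct.map (M.ρ (g.val : A)) LinearMap.id)
      ((tensor M (dual M)).ρ a (x ⊗ₜ[k] φ)) = counit (R := k) a * φ (M.ρ (g.val : A) x)
    rw [tensor_ρ_repr, map_sum]
    have h := congrArg (fun b => φ (M.ρ (antipode k b * (g.val : A)) x))
      (sum_antipode_mul_eq_smul (ℛ k a))
    have h' : ∀ b : A, (g.val : A) * b = antipode k (antipode k b) * (g.val : A) := fun b => by
      simp [g.antipode_antipode, mul_assoc]
    simp [antipode_mul_antidistrib, mul_assoc, ← h', Finset.sum_mul] at h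
    simpa [Module.Dual.transpose_apply] using h

theorem map_coevaluation (V : Type u) [AddCommGroup V] [Module k V] [Module.Finite k V]
    (f h : Module.End k V) :
    TensorProduct.map f (Module.Dual.transpose (R := k) h) (coevaluation k V 1) =
      TensorProduct.map (f ∘ₗ h) LinearMap.id (coevaluation k V 1) := by
  have h₁ : ∀ i, Module.Dual.transpose (R := k) h ((Module.Basis.ofVectorSpace k V).coord i) =
      ∑ j, (Module.Basis.ofVectorSpace k V).coord i (h (Module.Basis.ofVectorSpace k V j)) •
        (Module.Basis.ofVectorSpace k V).coord j := fun i =>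
    ((Module.Basis.ofVectorSpace k V).sum_dual_apply_smul_coord _).symm
  have h₂ : ∀ j, h (Module.Basis.ofVectorSpace k V j) =
      ∑ i, (Module.Basis.ofVectorSpace k V).coord i (h (Module.Basis.ofVectorSpace k V j)) •
        Module.Basis.ofVectorSpace k V i := fun j =>
    ((Module.Basis.ofVectorSpace k V).sum_repr _).symm
  rw [coevaluation_apply_one]
  simp only [map_sum, TensorProduct.map_tmul, LinearMap.comp_apply, LinearMap.id_apply]
  have h₃ : ∀ j, f (h (Module.Basis.ofVectorSpace k V j)) =
      ∑ i, (Module.Basis.ofVectorSpace k V).coord i (h (Module.Basis.ofVectorSpace k V j)) •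
        f (Module.Basis.ofVectorSpace k V i) := fun j => by
    conv_lhs => rw [h₂ j]
    simp only [map_sum, map_smul]
  simp_rw [h₁, h₃, TensorProduct.tmul_sum, TensorProduct.sum_tmul, TensorProduct.tmul_smul,
    TensorProduct.smul_tmul']
  exact Finset.sum_comm

/-- The linear map `a ↦ ∑ a e_i ⊗ e^i`. -/
def coevOrb (M : FDMod k A) : A →ₗ[k] M.V ⊗[k] Module.Dual k M.V :=
  LinearMap.applyₗ (coevaluation k M.V 1) ∘ₗ LinearMap.rTensorHom (Module.Dual k M.V) ∘ₗ
    M.ρ.toLinearMap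

theorem map_ρ_coevaluation (M : FDMod k A) (a b : A) :
    TensorProduct.map (M.ρ a) ((dual M).ρ b) (coevaluation k M.V 1) =
      M.coevOrb (a * antipode k b) := by
  refine (map_coevaluation M.V (M.ρ a) (M.ρ (antipode k b))).trans ?_
  change _ = TensorProduct.map (M.ρ (a * antipode k b)) LinearMap.id (coevaluation k M.V 1)
  rw [map_mul]
  rfl

/-- `1 ↦ ∑ e_i ⊗ e^i` -/
def coevL (M : FDMod k A) : triv k A ⟶ tensor M (dual M) where
  hom := coevaluation k M.V
  comm a := by
    refine LinearMap.ext_ring ?_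
    change coevaluation k M.V (counit (R := k) a * 1) =
      (tensor M (dual M)).ρ a (coevaluation k M.V 1)
    have h₁ : (tensor M (dual M)).ρ a = ∑ i ∈ (ℛ k a).index,
        TensorProduct.map (M.ρ ((ℛ k a).left i)) ((dual M).ρ ((ℛ k a).right i)) :=
      TensorProduct.ext' fun x φ => by
        rw [tensor_ρ_repr, LinearMap.sum_apply]
        rfl
    have h₃ := congrArg M.coevOrb (sum_mul_antipode_eq_smul (ℛ k a))
    rw [map_sum, map_smul] at h₃
    rw [h₁, LinearMap.sum_apply, Finset.sum_congr rfl fun i _ => map_ρ_coevaluation M _ _, h₃, ← smul_eq_mul, map_smul]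
    congr 1
    change _ = TensorProduct.map (M.ρ 1) LinearMap.id (coevaluation k M.V 1)
    rw [map_one M.ρ]
    exact (LinearMap.congr_fun TensorProduct.map_id _).symm

/-- `1 ↦ ∑ e^i ⊗ g⁻¹ e_i` -/
def coevR (g : Pivot k A) (M : FDMod k A) : triv k A ⟶ tensor (dual M) M where
  hom := (TensorProduct.comm k M.V (Module.Dual k M.V)).toLinearMap ∘ₗ
    TensorProduct.map (M.ρ ((g.val⁻¹ : Aˣ) : A)) LinearMap.id ∘ₗ coevaluation k M.V
  comm a := by
    refine LinearMap.ext_ring ?_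
    change TensorProduct.comm k M.V (Module.Dual k M.V)
        (TensorProduct.map (M.ρ ((g.val⁻¹ : Aˣ) : A)) LinearMap.id
          (coevaluation k M.V (counit (R := k) a * 1))) =
      (tensor (dual M) M).ρ a (TensorProduct.comm k M.V (Module.Dual k M.V)
        (TensorProduct.map (M.ρ ((g.val⁻¹ : Aˣ) : A)) LinearMap.id (coevaluation k M.V 1)))
    have h₁ : (tensor (dual M) M).ρ a ∘ₗ
        (TensorProduct.comm k M.V (Module.Dual k M.V)).toLinearMap ∘ₗ
        TensorProduct.map (M.ρ ((g.val⁻¹ : Aˣ) : A)) LinearMap.id =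
        (TensorProduct.comm k M.V (Module.Dual k M.V)).toLinearMap ∘ₗ ∑ i ∈ (ℛ k a).index,
        TensorProduct.map (M.ρ ((ℛ k a).right i * ((g.val⁻¹ : Aˣ) : A)))
          ((dual M).ρ ((ℛ k a).left i)) :=
      TensorProduct.ext' fun x φ => by
        change (tensor (dual M) M).ρ a (φ ⊗ₜ[k] M.ρ ((g.val⁻¹ : Aˣ) : A) x) = _
        rw [tensor_ρ_repr, LinearMap.comp_apply, LinearMap.sum_apply, map_sum]
        refine Finset.sum_congr rfl fun i _ => ?_
        rw [map_mul]
        rfl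
    have h' : ∀ b : A, b * ((g.val⁻¹ : Aˣ) : A) =
        ((g.val⁻¹ : Aˣ) : A) * antipode k (antipode k b) := fun b => by
      simp [g.antipode_antipode, mul_assoc]
    have h₄ : ∑ i ∈ (ℛ k a).index,
        ((ℛ k a).right i * ((g.val⁻¹ : Aˣ) : A)) * antipode k ((ℛ k a).left i) =
        counit (R := k) a • ((g.val⁻¹ : Aˣ) : A) := by
      have := congrArg (fun b => ((g.val⁻¹ : Aˣ) : A) * antipode k b)
        (sum_mul_antipode_eq_smul (ℛ k a))
      simp only [map_sum, antipode_mul_antidistrib, map_smul, antipode_one, Finset.mul_sum,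
        mul_smul_comm, mul_one] at this
      simpa only [h', mul_assoc] using this
    have h₃ := congrArg M.coevOrb h₄
    rw [map_sum, map_smul] at h₃
    have h₅ := LinearMap.congr_fun h₁ (coevaluation k M.V 1)
    rw [LinearMap.comp_apply _ (Finset.sum _ _), LinearMap.sum_apply,
      Finset.sum_congr rfl fun i _ => map_ρ_coevaluation M _ _, h₃] at h₅
    refine Eq.trans ?_ h₅.symm
    rw [← smul_eq_mul, map_smul, map_smul]
    rfl

theorem ρ_val_inv (g : Pivot k A) (M : FDMod k A) (m : M.V) :
    M.ρ (g.val : A) (M.ρ ((g.val⁻¹ : Aˣ) : A) m) = m := by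
  rw [← Module.End.mul_apply, ← map_mul, Units.mul_inv, map_one, Module.End.one_apply]

theorem ρ_inv_val (g : Pivot k A) (M : FDMod k A) (m : M.V) :
    M.ρ ((g.val⁻¹ : Aˣ) : A) (M.ρ (g.val : A) m) = m := by
  rw [← Module.End.mul_apply, ← map_mul, Units.inv_mul, map_one, Module.End.one_apply]

theorem leftMate_hom {X M : FDMod k A} (b : X ⊗ M ⟶ 𝟙_ (FDMod k A)) (x : X.V) (m : M.V) :
    (leftMate (D := dual M) (coevL M) b).hom x m = b.hom (x ⊗ₜ[k] m) := by
  change TensorProduct.lid k (Module.Dual k M.V) (TensorProduct.map b.hom LinearMap.id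
    ((TensorProduct.assoc k X.V M.V (Module.Dual k M.V)).symm
      (x ⊗ₜ[k] coevaluation k M.V 1))) m = _
  rw [coevaluation_apply_one]
  simp only [TensorProduct.tmul_sum, map_sum, TensorProduct.assoc_symm_tmul,
    TensorProduct.map_tmul, TensorProduct.lid_tmul, LinearMap.sum_apply]
  conv_rhs => rw [← (Module.Basis.ofVectorSpace k M.V).sum_repr m]
  simp only [TensorProduct.tmul_sum, map_sum, TensorProduct.tmul_smul, map_smul]
  exact Finset.sum_congr rfl fun i _ => mul_comm _ _

theorem rightMate_hom (g : Pivot k A) {X M : FDMod k A} (b : M ⊗ X ⟶ 𝟙_ (FDMod k A))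
    (x : X.V) (m : M.V) :
    (rightMate (D := dual M) (coevR g M) b).hom x m =
      b.hom (M.ρ ((g.val⁻¹ : Aˣ) : A) m ⊗ₜ[k] x) := by
  change TensorProduct.rid k (Module.Dual k M.V) (TensorProduct.map LinearMap.id b.hom
    (TensorProduct.assoc k (Module.Dual k M.V) M.V X.V
      ((TensorProduct.comm k M.V (Module.Dual k M.V)
        (TensorProduct.map (M.ρ ((g.val⁻¹ : Aˣ) : A)) LinearMap.id
          (coevaluation k M.V 1))) ⊗ₜ[k] x))) m = _
  rw [coevaluation_apply_one]
  simp only [TensorProduct.sum_tmul, map_sum, TensorProduct.assoc_tmul, TensorProduct.comm_tmul,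
    TensorProduct.map_tmul, TensorProduct.rid_tmul, LinearMap.sum_apply]
  conv_rhs => rw [← (Module.Basis.ofVectorSpace k M.V).sum_repr m]
  simp only [TensorProduct.sum_tmul, map_sum, map_smul]
  refine Finset.sum_congr rfl fun i _ => ?_
  rw [← TensorProduct.smul_tmul', map_smul]
  exact mul_comm _ _

/-- The pivotal structure on the category of finite-dimensional modules given by a pivot. -/
def pivotal (g : Pivot k A) : PivotalStructure (FDMod k A) where
  dual := dual
  coevL := coevL
  evL := evL
  coevR := coevR g
  evR := evR g
  coevL_evL M := hom_ext (contractLeft_assoc_coevaluation k M.V)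
  evL_coevL M := hom_ext (contractLeft_assoc_coevaluation' k M.V)
  coevR_evR M := by
    refine hom_ext (TensorProduct.ext' fun x (c : k) => ?_)
    change TensorProduct.map (contractRight k M.V ∘ₗ
        TensorProduct.map (M.ρ (g.val : A)) LinearMap.id) LinearMap.id
      ((TensorProduct.assoc k M.V (Module.Dual k M.V) M.V).symm (x ⊗ₜ[k]
        (TensorProduct.comm k M.V (Module.Dual k M.V)
          (TensorProduct.map (M.ρ ((g.val⁻¹ : Aˣ) : A)) LinearMap.id (coevaluation k M.V c))))) =
      1 ⊗ₜ[k] (c • x)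
    rw [← mul_one c, ← smul_eq_mul, map_smul, coevaluation_apply_one]
    simp only [TensorProduct.tmul_sum, map_sum, TensorProduct.assoc_symm_tmul, map_smul,
      TensorProduct.comm_tmul, TensorProduct.map_tmul, TensorProduct.tmul_smul,
      LinearMap.comp_apply, contractRight_apply, LinearMap.id_apply, smul_eq_mul, mul_one]
    congr 1
    have h := congrArg (M.ρ ((g.val⁻¹ : Aˣ) : A))
      ((Module.Basis.ofVectorSpace k M.V).sum_repr (M.ρ (g.val : A) x))
    rw [ρ_inv_val, map_sum] at h
    conv_rhs => rw [← h, TensorProduct.tmul_sum]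
    refine Finset.sum_congr rfl fun i _ => ?_
    rw [map_smul, TensorProduct.tmul_smul, TensorProduct.smul_tmul', smul_eq_mul, mul_one]
    rfl
  evR_coevR M := by
    refine hom_ext (TensorProduct.ext' fun (c : k) φ => ?_)
    change TensorProduct.map LinearMap.id (contractRight k M.V ∘ₗ
        TensorProduct.map (M.ρ (g.val : A)) LinearMap.id)
      (TensorProduct.assoc k (Module.Dual k M.V) M.V (Module.Dual k M.V)
        ((TensorProduct.comm k M.V (Module.Dual k M.V)
          (TensorProduct.map (M.ρ ((g.val⁻¹ : Aˣ) : A)) LinearMap.id (coevaluation k M.V c)))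
          ⊗ₜ[k] φ)) =
      (c • φ) ⊗ₜ[k] 1
    rw [← mul_one c, ← smul_eq_mul, map_smul, coevaluation_apply_one]
    simp only [TensorProduct.sum_tmul, map_sum, TensorProduct.assoc_tmul, map_smul,
      TensorProduct.comm_tmul, TensorProduct.map_tmul, ← TensorProduct.smul_tmul',
      LinearMap.comp_apply, contractRight_apply, LinearMap.id_apply, smul_eq_mul, mul_one,
      ρ_val_inv]
    congr 1
    conv_rhs => rw [← (Module.Basis.ofVectorSpace k M.V).sum_dual_apply_smul_coord φ,
      TensorProduct.sum_tmul]
    refine Finset.sum_congr rfl fun i _ => ?_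
    rw [TensorProduct.smul_tmul, smul_eq_mul, mul_one]
  transpose_eq {M N} f := by
    refine hom_ext (LinearMap.ext fun φ => LinearMap.ext fun m => ?_)
    rw [leftMate_hom, rightMate_hom]
    change φ (f.hom m) = φ (N.ρ (g.val : A) (f.hom (M.ρ ((g.val⁻¹ : Aˣ) : A) m)))
    rw [hom_ρ, ρ_val_inv]
  tensor_eq M N := by
    refine hom_ext (TensorProduct.ext' fun ψ φ => TensorProduct.ext' fun m n => ?_)
    refine (leftMate_hom (M := tensor M N) _ _ _).trans
      (Eq.trans ?_ (rightMate_hom g (M := tensor M N) _ _ _).symm)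
    have h : (tensor M N).ρ ((g.val⁻¹ : Aˣ) : A) (m ⊗ₜ[k] n) =
        M.ρ ((g.val⁻¹ : Aˣ) : A) m ⊗ₜ[k] N.ρ ((g.val⁻¹ : Aˣ) : A) n := by
      have h' : antipode k (g.val : A) = ((g.val⁻¹ : Aˣ) : A) :=
        Units.eq_inv_of_mul_eq_one_left g.isGroupLike.mul_antipode_cancel
      rw [tensor_ρ_tmul, ← h', g.isGroupLike.antipode.comul_eq_tmul_self]
      rfl
    rw [h]
    change ψ ((φ m) • n) = ψ (N.ρ (g.val : A) (N.ρ ((g.val⁻¹ : Aˣ) : A) n)) •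
      φ (M.ρ (g.val : A) (M.ρ ((g.val⁻¹ : Aˣ) : A) m))
    rw [ρ_val_inv, ρ_val_inv, map_smul, smul_eq_mul, smul_eq_mul, mul_comm]

end Pivotal

end FDMod

end Modules

/-! ### Integrals, unimodular and unibalanced Hopf algebras -/

noncomputable section Hopf

variable {k A : Type u} [Field k] [Ring A] [HopfAlgebra k A]

/-- A right integral: a linear form `l` such that `(l ⊗ Id)(Δ(x)) = l(x) 1` for all `x`. -/
def IsRightIntegral (l : A →ₗ[k] k) : Prop :=
  ∀ x : A, TensorProduct.lid k A (l.rTensor A (Coalgebra.comul x)) = l x • (1 : A)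

variable (k) in
/-- A left cointegral: a vector `c` such that `x c = ε(x) c` for all `x`. -/
def IsLeftCointegral (c : A) : Prop :=
  ∀ x : A, x * c = Coalgebra.counit (R := k) x • c

variable (k A) in
/-- `A` is unimodular if `S` fixes the left cointegrals (which form a line). -/
def IsUnimodular : Prop :=
  ∀ c : A, IsLeftCointegral k c → HopfAlgebra.antipode k c = c

/-- The Hopf algebra `A` with the pivot `g` is unibalanced if the left modified traces on the ideal
of projective objects (which form a line if `A` is unimodular) are also right modified traces. -/
def IsUnibalanced (g : Pivot k A) : Prop :=
  ∀ t : TraceFamily k (isProjective (FDMod k A)),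
    t.IsLeftMTrace (FDMod.pivotal g) → t.IsRightMTrace (FDMod.pivotal g)

namespace FDMod

variable [Module.Finite k A]

variable (k A) in
/-- The counit, as a morphism from the regular module to the unit object. -/
def counitHom : regular k A ⟶ 𝟙_ (FDMod k A) where
  hom := Coalgebra.counit
  comm a := LinearMap.ext fun (x : A) => Bialgebra.counit_mul a x

variable (k A) in
/-- The coproduct, as a morphism from the regular module to its tensor square. -/
def comulHom : regular k A ⟶ regular k A ⊗ regular k A where
  hom := Coalgebra.comul
  comm a := LinearMap.ext fun (x : A) => by
    change Coalgebra.comul (R := k) (a * x) =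
      (tensor (regular k A) (regular k A)).ρ a (Coalgebra.comul (R := k) x)
    rw [Bialgebra.comul_mul]
    induction Coalgebra.comul (R := k) x with
    | zero => simp
    | add y z hy hz => rw [mul_add, hy, hz, map_add]
    | tmul y z =>
      rw [tensor_ρ_tmul]
      induction Coalgebra.comul (R := k) a with
      | zero => simp
      | add u v hu hv => rw [add_mul, hu, hv, map_add]
      | tmul u v => rw [Algebra.TensorProduct.tmul_mul_tmul]; rfl

/-- The morphism from the unit object to the regular module that carries `1` to the left
cointegral `c`. -/
def cointegralHom (c : A) (hc : IsLeftCointegral k c) : 𝟙_ (FDMod k A) ⟶ regular k A where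
  hom := LinearMap.toSpanSingleton k A c
  comm a := LinearMap.ext_ring <| by
    change (Coalgebra.counit (R := k) a * 1) • c = a * ((1 : k) • c)
    rw [mul_one, one_smul, hc a]

/-- The morphism from the regular module `A` to `A* ⊗ A` that carries `1` to `l ⊗ 1`. -/
def integralHom (l : A →ₗ[k] k) : regular k A ⟶ dual (regular k A) ⊗ regular k A :=
  ofElem (dual (regular k A) ⊗ regular k A) (l ⊗ₜ[k] (1 : A))

/-- The morphism `(evR_A ⊗ Id_{A ⊗ A}) ∘ (Id_A ⊗ f ⊗ Id_A) ∘ (Id_A ⊗ Δ)`, where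
`f : A ⟶ A* ⊗ A` carries `1` to `l ⊗ 1`. -/
def dTilde (g : Pivot k A) (l : A →ₗ[k] k) :
    regular k A ⊗ regular k A ⟶ regular k A ⊗ regular k A :=
  regular k A ◁ (comulHom k A ≫ integralHom l ▷ regular k A ≫
      (α_ (dual (regular k A)) (regular k A) (regular k A)).hom) ≫
    (α_ (regular k A) (dual (regular k A)) (regular k A ⊗ regular k A)).inv ≫
    (pivotal g).evR (regular k A) ▷ (regular k A ⊗ regular k A) ≫
    (λ_ (regular k A ⊗ regular k A)).hom

end FDMod

end Hopf

/-!
By the Larson–Sweedler theorem there is a right integral `l` with `(a, b) ↦ l(ab)` nondegenerate,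
and representing the counit by this form gives a left cointegral `c` with `l(c) = 1`. If `A` is
unimodular, then `l(S²(y) b) = l(b y)`, so `τ(a) = l(S(g⁻¹ a))` is a symmetric form on `A`. As `A`
generates the projective modules, `τ` extends uniquely to a cyclic family of linear forms on them;
it is a left modified trace because `W ⊗ A` is free and `τ(a₂) a₁ = τ(a) g`, and it is
nondegenerate because `Hom(𝟙, A)` and `Hom(A, 𝟙)` are the lines spanned by `c` and `ε`.

Since `A ⊗ A*` is free on `A*`, its dual basis sum is `a ⊗ φ ↦ c · (1 ⊗ S(a) φ)`. The composite of
this map with the candidate for the chromatic morphism collapses to the identity, because the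
trace of `y ↦ u l(S(z₁) y) z₂` is `ε(z) l(u)` and because `l(S(c₂) a) c₁ = a`.
-/

section HopfIdentities

variable {R A B : Type*} [CommSemiring R] [Semiring A] [HopfAlgebra R A] [Semiring B] [Algebra R B]

open Coalgebra HopfAlgebra WithConv Algebra.TensorProduct

theorem algHom_convMul_comp_antipode (h : A →ₐ[R] B) :
    toConv h.toLinearMap * toConv (h.toLinearMap ∘ₗ antipode R) = 1 := by
  ext a
  have := congr(h $(sum_mul_antipode_eq_smul (ℛ R a)))
  simpa [(ℛ R a).convMul_apply, Algebra.algebraMap_eq_smul_one] using this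

theorem comp_antipode_convMul_algHom (h : A →ₐ[R] B) :
    toConv (h.toLinearMap ∘ₗ antipode R) * toConv h.toLinearMap = 1 := by
  ext a
  have := congr(h $(sum_antipode_mul_eq_smul (ℛ R a)))
  simpa [(ℛ R a).convMul_apply, Algebra.algebraMap_eq_smul_one] using this

variable (R A) in
theorem includeLeft_convMul_includeRight :
    toConv (includeLeft : A →ₐ[R] A ⊗[R] A).toLinearMap *
      toConv (includeRight : A →ₐ[R] A ⊗[R] A).toLinearMap = toConv comul := by
  ext a
  simpa [(ℛ R a).convMul_apply] using (ℛ R a).eq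

variable {ι : Type*} {a : A} (𝓡 : Repr R a ι)

theorem comul_antipode_eq_sum : comul (R := R) (antipode R a) =
    ∑ i ∈ 𝓡.index, antipode R (𝓡.right i) ⊗ₜ[R] antipode R (𝓡.left i) := by
  have h : toConv ((includeRight : A →ₐ[R] A ⊗[R] A).toLinearMap ∘ₗ antipode R) *
      toConv ((includeLeft : A →ₐ[R] A ⊗[R] A).toLinearMap ∘ₗ antipode R) =
      toConv (comul ∘ₗ antipode R) := by
    refine left_inv_eq_right_inv (a := toConv comul) ?_
      (algHom_convMul_comp_antipode (Bialgebra.comulAlgHom R A))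
    rw [← includeLeft_convMul_includeRight, mul_assoc,
      ← mul_assoc _ (toConv (includeLeft : A →ₐ[R] A ⊗[R] A).toLinearMap),
      comp_antipode_convMul_algHom, one_mul, comp_antipode_convMul_algHom]
  simpa [𝓡.convMul_apply] using congr($h.symm a)

theorem sum_comul_mul_one_tmul_antipode : ∑ i ∈ 𝓡.index,
    comul (R := R) (𝓡.left i) * ((1 : A) ⊗ₜ[R] antipode R (𝓡.right i)) = a ⊗ₜ[R] 1 := by
  have h : toConv comul * toConv ((includeRight : A →ₐ[R] A ⊗[R] A).toLinearMap ∘ₗ antipode R) =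
      toConv (includeLeft : A →ₐ[R] A ⊗[R] A).toLinearMap := by
    rw [← includeLeft_convMul_includeRight, mul_assoc, algHom_convMul_comp_antipode, mul_one]
  simpa [𝓡.convMul_apply] using congr($h a)

theorem sum_one_tmul_mul_comul_antipode : ∑ i ∈ 𝓡.index,
    ((1 : A) ⊗ₜ[R] 𝓡.left i) * comul (R := R) (antipode R (𝓡.right i)) =
      antipode R a ⊗ₜ[R] 1 := by
  have h : toConv ((includeLeft : A →ₐ[R] A ⊗[R] A).toLinearMap ∘ₗ antipode R) =
      toConv (includeRight : A →ₐ[R] A ⊗[R] A).toLinearMap * toConv (comul ∘ₗ antipode R) := by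
    refine left_inv_eq_right_inv (comp_antipode_convMul_algHom includeLeft) ?_
    rw [← mul_assoc, includeLeft_convMul_includeRight]
    exact algHom_convMul_comp_antipode (Bialgebra.comulAlgHom R A)
  simpa [𝓡.convMul_apply] using congr($h.symm a)

theorem sum_tmul_one_mul_antipode_map_comul : ∑ i ∈ 𝓡.index, (𝓡.left i ⊗ₜ[R] (1 : A)) *
    TensorProduct.map (antipode R) LinearMap.id (comul (R := R) (𝓡.right i)) = 1 ⊗ₜ[R] a := by
  have hS : toConv ((includeLeft : A →ₐ[R] A ⊗[R] A).toLinearMap ∘ₗ antipode R) *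
      toConv (includeRight : A →ₐ[R] A ⊗[R] A).toLinearMap =
      toConv (TensorProduct.map (antipode R) LinearMap.id ∘ₗ comul) := by
    ext a
    simp [(ℛ R a).convMul_apply, ← (ℛ R a).eq]
  have h : toConv (includeLeft : A →ₐ[R] A ⊗[R] A).toLinearMap *
      toConv (TensorProduct.map (antipode R) LinearMap.id ∘ₗ comul) =
      toConv (includeRight : A →ₐ[R] A ⊗[R] A).toLinearMap := by
    rw [← hS, ← mul_assoc, algHom_convMul_comp_antipode, one_mul]
  simpa [𝓡.convMul_apply] using congr($h a)

end HopfIdentities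

section LarsonSweedler

open Coalgebra HopfAlgebra WithConv

section DualBasis

variable {R C M ι : Type*} [CommSemiring R] [AddCommMonoid C] [Module R C] [AddCommMonoid M]
  [Module R M] [Fintype ι] (b : Module.Basis ι R C)

theorem sum_coord_smul_map (F : C →ₗ[R] M) (x : C) : ∑ i, b.coord i x • F (b i) = F x := by
  conv_rhs => rw [← b.sum_repr x, map_sum]
  simp only [map_smul, Module.Basis.coord_apply]

theorem sum_smul_tmul_eq_self (z : C ⊗[R] C) :
    ∑ i, ∑ j, LinearMap.mul' R R (TensorProduct.map (b.coord i) (b.coord j) z) • (b i ⊗ₜ[R] b j) =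
      z := by
  conv_rhs => rw [← (b.tensorProduct b).sum_repr z]
  rw [Fintype.sum_prod_type]
  refine Finset.sum_congr rfl fun i _ => Finset.sum_congr rfl fun j _ => ?_
  rw [Module.Basis.tensorProduct_apply]
  congr 1
  induction z with
  | zero => simp
  | tmul x y => simp [mul_comm]
  | add x y hx hy => simp [hx, hy]

theorem sum_comul_coord [Coalgebra R C] (Γ : WithConv (C →ₗ[R] R) →ₗ[R] C →ₗ[R] C →ₗ[R] M) :
    ∑ i, ∑ m ∈ (ℛ R (b i)).index,
      Γ (toConv (b.coord i)) ((ℛ R (b i)).left m) ((ℛ R (b i)).right m) =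
      ∑ i, ∑ j, Γ (toConv (b.coord i) * toConv (b.coord j)) (b i) (b j) := by
  have expand (i j : ι) : toConv (b.coord i) * toConv (b.coord j) =
      ∑ l, (toConv (b.coord i) * toConv (b.coord j)) (b l) • toConv (b.coord l) := by
    simpa using congr(toConv $(b.sum_dual_apply_smul_coord
      (toConv (b.coord i) * toConv (b.coord j)).ofConv)).symm
  have lift_comul (l : ι) : ∑ m ∈ (ℛ R (b l)).index,
      Γ (toConv (b.coord l)) ((ℛ R (b l)).left m) ((ℛ R (b l)).right m) =
      TensorProduct.lift (Γ (toConv (b.coord l))) (comul (b l)) := by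
    conv_rhs => rw [← (ℛ R (b l)).eq, map_sum]
    simp
  simp_rw [lift_comul]
  calc _ = ∑ l, ∑ i, ∑ j, (toConv (b.coord i) * toConv (b.coord j)) (b l) •
        Γ (toConv (b.coord l)) (b i) (b j) := by
        refine Finset.sum_congr rfl fun l _ => ?_
        conv_lhs => rw [← sum_smul_tmul_eq_self b (comul (b l))]
        simp only [map_sum, map_smul, TensorProduct.lift.tmul]
        rfl
    _ = _ := by
        rw [Finset.sum_comm]
        refine Finset.sum_congr rfl fun i _ => ?_
        rw [Finset.sum_comm]
        refine Finset.sum_congr rfl fun j _ => ?_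
        conv_rhs => rw [expand i j]
        simp

end DualBasis

variable {R A : Type*} [CommSemiring R] [Semiring A] [HopfAlgebra R A]

variable (R A) in
/-- The left action `(a • f)(x) = f(S(a) x)` of a Hopf algebra on its dual convolution algebra. -/
noncomputable def antipodeAct :
    A →ₗ[R] WithConv (A →ₗ[R] R) →ₗ[R] WithConv (A →ₗ[R] R) :=
  LinearMap.mk₂ R (fun a f => toConv (f.ofConv ∘ₗ LinearMap.mulLeft R (antipode R a)))
    (fun _ _ _ => by ext; simp [add_mul]) (fun _ _ _ => by ext; simp)
    (fun _ _ _ => by ext; simp) (fun _ _ _ => by ext; simp)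

theorem antipodeAct_apply (a : A) (f : WithConv (A →ₗ[R] R)) (x : A) :
    antipodeAct R A a f x = f (antipode R a * x) := rfl

theorem antipodeAct_antipodeAct (a b : A) (f : WithConv (A →ₗ[R] R)) :
    antipodeAct R A a (antipodeAct R A b f) = antipodeAct R A (a * b) f := by
  ext x
  simp only [antipodeAct_apply, antipode_mul_antidistrib, mul_assoc]

theorem antipodeAct_one (f : WithConv (A →ₗ[R] R)) : antipodeAct R A 1 f = f := by
  ext x
  simp only [antipodeAct_apply, antipode_one, one_mul]

/-- The expansion `Δ(S(a)) = S(a₂) ⊗ S(a₁)` of the coproduct of an antipode. -/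
def antipodeRepr {ι : Type*} {a : A} (𝓡 : Repr R a ι) : Repr R (antipode R a) ι where
  index := 𝓡.index
  left i := antipode R (𝓡.right i)
  right i := antipode R (𝓡.left i)
  eq := (comul_antipode_eq_sum 𝓡).symm

theorem antipodeAct_convMul {ι : Type*} {a : A} (𝓡 : Repr R a ι) (f h : WithConv (A →ₗ[R] R)) :
    antipodeAct R A a f * h = ∑ i ∈ 𝓡.index, antipodeAct R A (𝓡.right i)
      (f * toConv (h.ofConv ∘ₗ LinearMap.mulLeft R (𝓡.left i))) := by
  have map_mul_left (u v : A) (z : A ⊗[R] A) :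
      TensorProduct.map (f.ofConv ∘ₗ LinearMap.mulLeft R u) (h.ofConv ∘ₗ LinearMap.mulLeft R v) z =
        TensorProduct.map f.ofConv h.ofConv ((u ⊗ₜ[R] v) * z) := by
    rw [TensorProduct.map_comp, LinearMap.comp_apply, ← LinearMap.mulLeft_tmul,
      LinearMap.mulLeft_apply]
  ext x
  have key := congr(LinearMap.mul' R R (TensorProduct.map f.ofConv h.ofConv
    ($(sum_one_tmul_mul_comul_antipode 𝓡) * comul x)))
  have lhs : (antipodeAct R A a f * h) x = LinearMap.mul' R R (TensorProduct.map f.ofConv h.ofConv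
      ((antipode R a ⊗ₜ[R] 1) * comul x)) := by
    rw [← map_mul_left, LinearMap.mulLeft_one]
    rfl
  rw [lhs, ← key, Finset.sum_mul, map_sum, map_sum]
  have rhs (i : ι) : antipodeAct R A (𝓡.right i)
      (f * toConv (h.ofConv ∘ₗ LinearMap.mulLeft R (𝓡.left i))) x =
      LinearMap.mul' R R (TensorProduct.map f.ofConv h.ofConv
        (((1 : A) ⊗ₜ[R] 𝓡.left i) * comul (antipode R (𝓡.right i)) * comul x)) := by
    rw [mul_assoc, ← Bialgebra.comul_mul, ← map_mul_left, LinearMap.mulLeft_one]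
    rfl
  simp only [← rhs]
  simp

section Projection

variable {ι : Type*} [Fintype ι] (b : Module.Basis ι R A)

theorem sum_coord_convMul_antipodeAct (h : WithConv (A →ₗ[R] R)) :
    ∑ i, toConv (b.coord i) * antipodeAct R A (b i) h = h 1 • 1 := by
  ext x
  have expand (y z : A) : ∑ i, b.repr y i * h (antipode R (b i) * z) = h (antipode R y * z) :=
    sum_coord_smul_map b (h.ofConv ∘ₗ LinearMap.mulRight R z ∘ₗ antipode R) y
  have hS := congr(h $(sum_antipode_mul_eq_smul (ℛ R x)))
  simp only [WithConv.ofConv_sum, LinearMap.sum_apply, (ℛ R x).convMul_apply]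
  rw [Finset.sum_comm]
  simpa [antipodeAct_apply, expand, mul_comm] using hS

/-- The projection `f ↦ ∑ i, S(b i) • (f * bⁱ)` of the dual convolution algebra onto the space of
right integrals, where `•` is `antipodeAct`. -/
noncomputable def integralProjection (f : WithConv (A →ₗ[R] R)) : WithConv (A →ₗ[R] R) :=
  ∑ i, antipodeAct R A (antipode R (b i)) (f * toConv (b.coord i))

theorem integralProjection_convMul (f h : WithConv (A →ₗ[R] R)) :
    integralProjection b f * h = h 1 • integralProjection b f := by
  let Γ : WithConv (A →ₗ[R] R) →ₗ[R] A →ₗ[R] A →ₗ[R] WithConv (A →ₗ[R] R) :=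
    LinearMap.mk₂ R (fun g y => antipodeAct R A (antipode R y) ∘ₗ LinearMap.mulLeft R (f * g) ∘ₗ
      (antipodeAct R A).flip h) (fun _ _ _ => by ext1; simp [mul_assoc, mul_add, add_mul])
      (fun _ _ _ => by ext1; simp [smul_mul_assoc]) (fun _ _ _ => by ext1; simp)
      (fun _ _ _ => by ext1; simp)
  calc integralProjection b f * h
    _ = ∑ i, ∑ m ∈ (ℛ R (b i)).index,
          Γ (toConv (b.coord i)) ((ℛ R (b i)).left m) ((ℛ R (b i)).right m) := by
        simp only [integralProjection, Finset.sum_mul,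
          antipodeAct_convMul (antipodeRepr (ℛ R (b _)))]
        rfl
    _ = ∑ i, antipodeAct R A (antipode R (b i)) (f * toConv (b.coord i) *
          ∑ j, toConv (b.coord j) * antipodeAct R A (b j) h) := by
        rw [sum_comul_coord]
        simp [Γ, Finset.mul_sum, mul_assoc]
    _ = h 1 • integralProjection b f := by
        simp [sum_coord_convMul_antipodeAct, integralProjection, Finset.smul_sum]

theorem sum_antipodeAct_integralProjection_coord :
    ∑ j, antipodeAct R A (b j) (integralProjection b (toConv (b.coord j))) = 1 := by
  let Γ : WithConv (A →ₗ[R] R) →ₗ[R] A →ₗ[R] A →ₗ[R] WithConv (A →ₗ[R] R) :=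
    LinearMap.mk₂ R (fun g y => (antipodeAct R A).flip g ∘ₗ LinearMap.mulLeft R y ∘ₗ antipode R)
      (fun _ _ _ => by ext1; simp) (fun _ _ _ => by ext1; simp)
      (fun _ _ _ => by ext1; simp [add_mul]) (fun _ _ _ => by ext1; simp)
  calc ∑ j, antipodeAct R A (b j) (integralProjection b (toConv (b.coord j)))
    _ = ∑ j, ∑ i, Γ (toConv (b.coord j) * toConv (b.coord i)) (b j) (b i) := by
        simp [integralProjection, antipodeAct_antipodeAct, Γ]
    _ = ∑ i, antipodeAct R A (∑ m ∈ (ℛ R (b i)).index,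
          (ℛ R (b i)).left m * antipode R ((ℛ R (b i)).right m)) (toConv (b.coord i)) := by
        rw [← sum_comul_coord]
        simp [Γ]
    _ = 1 := by
        simp only [sum_mul_antipode_eq_smul, map_smul, LinearMap.smul_apply, antipodeAct_one]
        ext x
        simp

end Projection

end LarsonSweedler

section Integrals

variable {k A : Type u} [Field k] [Ring A] [HopfAlgebra k A]

open Coalgebra HopfAlgebra WithConv

theorem isRightIntegral_iff {l : A →ₗ[k] k} :
    IsRightIntegral l ↔ ∀ h : WithConv (A →ₗ[k] k), toConv l * h = h 1 • toConv l := by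
  have key (h : WithConv (A →ₗ[k] k)) (x : A) :
      h (TensorProduct.lid k A (l.rTensor A (comul x))) = (toConv l * h) x := by
    rw [(ℛ k x).convMul_apply, ← (ℛ k x).eq]
    simp
  constructor
  · intro hl h
    ext x
    rw [← key, hl x]
    simp [mul_comm]
  · intro hl x
    rw [← sub_eq_zero, ← Module.forall_dual_apply_eq_zero_iff k]
    intro h
    rw [map_sub, sub_eq_zero]
    simpa [hl, mul_comm] using key (toConv h) x

variable [Module.Finite k A]

variable (k A) in
theorem exists_isRightIntegral_ne_zero : ∃ l : A →ₗ[k] k, IsRightIntegral l ∧ l ≠ 0 := by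
  by_contra! H
  let b := Module.finBasis k A
  have vanish (f : WithConv (A →ₗ[k] k)) : integralProjection b f = 0 :=
    WithConv.ofConv_injective <| H _ <| isRightIntegral_iff.2 <| integralProjection_convMul b f
  have h := congr($(sum_antipodeAct_integralProjection_coord b) 1)
  simp [vanish] at h

theorem IsRightIntegral.eq_zero_of_antipodeAct_eq_zero {l : A →ₗ[k] k} (hl : IsRightIntegral l)
    (hl₀ : l ≠ 0) {a : A} (ha : antipodeAct k A a (toConv l) = 0) : a = 0 := by
  let b := Module.finBasis k A
  have sum_form (h : A →ₗ[k] k) : ∑ i ∈ (ℛ k a).index,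
      h ((ℛ k a).left i) • antipodeAct k A ((ℛ k a).right i) (toConv l) = 0 := by
    have := (antipodeAct_convMul (ℛ k a) (toConv l) (toConv h)).symm
    simpa [ha, isRightIntegral_iff.1 hl] using this
  have convMul_id (F : A →ₗ[k] A) :
      antipodeAct k A ((toConv F * toConv LinearMap.id).ofConv a) (toConv l) = 0 := by
    have expand (i) : F ((ℛ k a).left i) = ∑ j, b.coord j ((ℛ k a).left i) • F (b j) :=
      (sum_coord_smul_map b F _).symm
    simp only [(ℛ k a).convMul_apply, expand, Finset.sum_mul]
    rw [Finset.sum_comm, map_sum, LinearMap.sum_apply]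
    refine Finset.sum_eq_zero fun j _ => ?_
    have := congr(antipodeAct k A (F (b j)) $(sum_form (b.coord j)))
    simpa [antipodeAct_antipodeAct] using this
  refine (Module.forall_dual_apply_eq_zero_iff k a).1 fun h => ?_
  have := convMul_id (toConv (h.smulRight 1) * toConv (antipode k)).ofConv
  rw [toConv_ofConv, mul_assoc, LinearMap.antipode_mul_id, mul_one] at this
  simpa [antipodeAct_one, hl₀] using this

theorem antipode_injective : Function.Injective (antipode k : A →ₗ[k] A) := by
  obtain ⟨l, hl, hl₀⟩ := exists_isRightIntegral_ne_zero k A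
  refine (injective_iff_map_eq_zero _).2 fun a ha => hl.eq_zero_of_antipodeAct_eq_zero hl₀ ?_
  ext x
  simp [antipodeAct_apply, ha]

variable (k A) in
/-- The antipode of a finite-dimensional Hopf algebra, as a linear automorphism. -/
noncomputable def antipodeEquiv : A ≃ₗ[k] A :=
  LinearEquiv.ofInjectiveEndo (antipode k) antipode_injective

@[simp]
theorem antipode_antipodeEquiv_symm (x : A) : antipode k ((antipodeEquiv k A).symm x) = x :=
  (antipodeEquiv k A).apply_symm_apply x

@[simp]
theorem antipodeEquiv_symm_antipode (x : A) : (antipodeEquiv k A).symm (antipode k x) = x :=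
  (antipodeEquiv k A).symm_apply_apply x

theorem antipodeEquiv_symm_mul (x y : A) : (antipodeEquiv k A).symm (x * y) =
    (antipodeEquiv k A).symm y * (antipodeEquiv k A).symm x :=
  antipode_injective (k := k) (by simp [antipode_mul_antidistrib])

theorem IsRightIntegral.nondegenerate {l : A →ₗ[k] k} (hl : IsRightIntegral l) (hl₀ : l ≠ 0) :
    ((LinearMap.mul k A).compr₂ l).Nondegenerate := by
  refine LinearMap.BilinForm.Nondegenerate.ofSeparatingLeft fun a ha => ?_
  rw [← antipode_antipodeEquiv_symm (k := k) a] at ha ⊢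
  rw [hl.eq_zero_of_antipodeAct_eq_zero hl₀ (a := (antipodeEquiv k A).symm a)
    (by ext x; exact ha x), map_zero]

/-- A right integral and a left cointegral that are dual to each other. -/
structure IsIntegralPair (l : A →ₗ[k] k) (c : A) : Prop where
  isRightIntegral : IsRightIntegral l
  isLeftCointegral : IsLeftCointegral k c
  apply_eq_one : l c = 1

variable (k A) in
theorem exists_isIntegralPair : ∃ (l : A →ₗ[k] k) (c : A), IsIntegralPair l c := by
  obtain ⟨l, hl, hl₀⟩ := exists_isRightIntegral_ne_zero k A
  have hB := hl.nondegenerate hl₀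
  have hB' := LinearMap.BilinForm.nondegenerate_flip_iff.2 hB
  let c := (LinearMap.BilinForm.toDual _ hB').symm (counit (R := k) (A := A))
  have hc (x : A) : l (x * c) = counit (R := k) x :=
    LinearMap.BilinForm.apply_toDual_symm_apply (hB := hB') (counit (R := k) (A := A)) x
  refine ⟨l, c, hl, fun x => ?_, by simpa using hc 1⟩
  rw [← sub_eq_zero]
  refine hB.2 _ fun y => ?_
  simp [mul_sub, ← mul_assoc, hc, mul_comm]

end Integrals

section IntegralPair

variable {k A : Type u} [Field k] [Ring A] [HopfAlgebra k A] {l : A →ₗ[k] k} {c : A}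

open Coalgebra HopfAlgebra WithConv

theorem IsRightIntegral.sum_mul_antipode (hl : IsRightIntegral l) (a b : A) :
    ∑ i ∈ (ℛ k b).index, l (a * (ℛ k b).left i) • antipode k ((ℛ k b).right i) =
      ∑ i ∈ (ℛ k a).index, l ((ℛ k a).left i * b) • (ℛ k a).right i := by
  let P : WithConv (A →ₗ[k] A) := toConv ((l ∘ₗ LinearMap.mulLeft k a).smulRight (1 : A))
  let Q : WithConv (A →ₗ[k] A) := toConv (∑ i ∈ (ℛ k a).index,
    (l ∘ₗ LinearMap.mulLeft k ((ℛ k a).left i)).smulRight ((ℛ k a).right i))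
  have hQP : Q * toConv LinearMap.id = P := by
    ext b
    have hab := hl (a * b)
    rw [Bialgebra.comul_mul, ← (ℛ k b).eq, ← (ℛ k a).eq] at hab
    rw [(ℛ k b).convMul_apply]
    simpa [P, Q, Finset.sum_mul, Finset.mul_sum] using hab
  have hPQ : P * toConv (antipode k) = Q := by
    rw [← hQP, mul_assoc, LinearMap.id_mul_antipode, mul_one]
  simpa [P, Q, (ℛ k b).convMul_apply] using congr($hPQ b)

namespace IsIntegralPair

theorem sum_smul_antipode_right (h : IsIntegralPair l c) (a : A) :
    ∑ i ∈ (ℛ k c).index, l (a * (ℛ k c).left i) • antipode k ((ℛ k c).right i) = a := by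
  rw [h.isRightIntegral.sum_mul_antipode]
  simpa [h.isLeftCointegral _, h.apply_eq_one] using sum_counit_smul (ℛ k a)

variable [Module.Finite k A]

theorem ext_of_forall_mul_right (h : IsIntegralPair l c) {x y : A}
    (hxy : ∀ a, l (a * x) = l (a * y)) : x = y := by
  have hl₀ : l ≠ 0 := fun hl => by simpa [hl] using h.apply_eq_one
  rw [← sub_eq_zero]
  refine (h.isRightIntegral.nondegenerate hl₀).2 _ fun a => ?_
  simp [mul_sub, hxy]

theorem eq_smul_of_isLeftCointegral (h : IsIntegralPair l c) {x : A} (hx : IsLeftCointegral k x) :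
    x = l x • c :=
  h.ext_of_forall_mul_right fun a => by
    simp [hx a, h.isLeftCointegral a, h.apply_eq_one, mul_comm]

theorem sum_smul_left (h : IsIntegralPair l c) (b : A) :
    ∑ i ∈ (ℛ k c).index, l (antipode k ((ℛ k c).right i) * b) • (ℛ k c).left i = b := by
  refine h.ext_of_forall_mul_right fun a => ?_
  conv_rhs => rw [← h.sum_smul_antipode_right a]
  simp [Finset.mul_sum, Finset.sum_mul, mul_comm]

end IsIntegralPair

variable [Module.Finite k A]

theorem IsUnimodular.mul_eq_smul (hA : IsUnimodular k A) (hc : IsLeftCointegral k c) (x : A) :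
    c * x = counit (R := k) x • c := by
  have h := congr(antipode k $(hc ((antipodeEquiv k A).symm x)))
  rw [antipode_mul_antidistrib, hA c hc, map_smul, hA c hc, antipode_antipodeEquiv_symm] at h
  rw [h, ← counit_antipode, antipode_antipodeEquiv_symm]

namespace IsIntegralPair

theorem sum_smul_right (h : IsIntegralPair l c) (hA : IsUnimodular k A) (b : A) :
    ∑ i ∈ (ℛ k c).index, l ((ℛ k c).left i * b) • (ℛ k c).right i = antipode k b := by
  rw [← h.isRightIntegral.sum_mul_antipode]
  simpa [hA.mul_eq_smul h.isLeftCointegral, h.apply_eq_one] using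
    congr(antipode k $(sum_counit_smul (ℛ k b)))

theorem apply_antipode_antipode_mul (h : IsIntegralPair l c) (hA : IsUnimodular k A) (y b : A) :
    l (antipode k (antipode k y) * b) = l (b * y) := by
  conv_rhs => rw [← h.sum_smul_left b]
  rw [← h.sum_smul_right hA y]
  simp [Finset.sum_mul, mul_comm]

end IsIntegralPair

end IntegralPair

section SymmetrizedIntegral

variable {k A : Type u} [Field k] [Ring A] [HopfAlgebra k A] (g : Pivot k A)

open Coalgebra HopfAlgebra

namespace Pivot

theorem antipode_val : antipode k (g.val : A) = ((g.val⁻¹ : Aˣ) : A) :=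
  Units.eq_inv_of_mul_eq_one_left g.isGroupLike.mul_antipode_cancel

theorem antipode_val_inv : antipode k ((g.val⁻¹ : Aˣ) : A) = (g.val : A) := by
  rw [← g.antipode_val, g.isGroupLike.antipode_antipode]

end Pivot

/-- The linear form `a ↦ l(S(g⁻¹ a))`, which is symmetric if `A` is unimodular and `l` is a right
integral. -/
noncomputable def symmetrizedIntegral (l : A →ₗ[k] k) : A →ₗ[k] k :=
  l ∘ₗ antipode k ∘ₗ LinearMap.mulLeft k ((g.val⁻¹ : Aˣ) : A)

theorem symmetrizedIntegral_apply (l : A →ₗ[k] k) (a : A) :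
    symmetrizedIntegral g l a = l (antipode k a * (g.val : A)) := by
  simp [symmetrizedIntegral, antipode_mul_antidistrib, g.antipode_val_inv]

variable [Module.Finite k A] {l : A →ₗ[k] k} {c : A}

theorem IsRightIntegral.sum_symmetrizedIntegral_smul (hl : IsRightIntegral l) (a : A) :
    ∑ i ∈ (ℛ k a).index, symmetrizedIntegral g l ((ℛ k a).right i) • (ℛ k a).left i =
      symmetrizedIntegral g l a • (g.val : A) := by
  have h := hl (antipode k a * (g.val : A))
  rw [Bialgebra.comul_mul, comul_antipode_eq_sum (ℛ k a), g.isGroupLike.comul_eq_tmul_self] at h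
  simp only [Finset.sum_mul, Algebra.TensorProduct.tmul_mul_tmul, map_sum,
    LinearMap.rTensor_tmul, TensorProduct.lid_tmul, ← symmetrizedIntegral_apply] at h
  refine antipode_injective (k := k) ?_
  simpa [Finset.sum_mul, mul_assoc, g.antipode_val] using congr($h * ((g.val⁻¹ : Aˣ) : A))

namespace IsIntegralPair

theorem symmetrizedIntegral_mul_comm (h : IsIntegralPair l c) (hA : IsUnimodular k A) (a b : A) :
    symmetrizedIntegral g l (a * b) = symmetrizedIntegral g l (b * a) := by
  simp only [symmetrizedIntegral_apply, antipode_mul_antidistrib]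
  have swap := h.apply_antipode_antipode_mul hA (((g.val⁻¹ : Aˣ) : A) * antipode k b * (g.val : A))
    (antipode k a * (g.val : A))
  rw [g.antipode_antipode] at swap
  simpa [mul_assoc] using swap

theorem symmetrizedIntegral_cointegral (h : IsIntegralPair l c) (hA : IsUnimodular k A) :
    symmetrizedIntegral g l c = 1 := by
  rw [symmetrizedIntegral_apply, hA c h.isLeftCointegral, hA.mul_eq_smul h.isLeftCointegral,
    g.isGroupLike.counit_eq_one, one_smul, h.apply_eq_one]

end IsIntegralPair

end SymmetrizedIntegral

section CyclicForms

variable {C : Type u} [Category.{v} C] [Preadditive C] {ι κ : Type*} [Fintype ι] [Fintype κ]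

theorem projective_of_id_eq_sum {P Q : C} [Projective Q] (f : ι → (Q ⟶ P)) (g : ι → (P ⟶ Q))
    (h : 𝟙 P = ∑ j, g j ≫ f j) : Projective P where
  factors φ e _ := ⟨∑ j, g j ≫ Projective.factorThru (f j ≫ φ) e, by
    conv_rhs => rw [← Category.id_comp φ, h]
    simp [Preadditive.sum_comp]⟩

variable {k : Type w} [Field k] [Linear k C] {G : C} {T : (G ⟶ G) →ₗ[k] k}

theorem sum_cyclic_eq_sum_cyclic (hT : ∀ a b : G ⟶ G, T (a ≫ b) = T (b ≫ a)) {U V : C}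
    {f : ι → (G ⟶ V)} {g : ι → (V ⟶ G)} (h : 𝟙 V = ∑ j, g j ≫ f j)
    {f' : κ → (G ⟶ U)} {g' : κ → (U ⟶ G)} (h' : 𝟙 U = ∑ j, g' j ≫ f' j)
    (q : V ⟶ U) (p : U ⟶ V) :
    ∑ j, T (f j ≫ (q ≫ p) ≫ g j) = ∑ i, T (f' i ≫ (p ≫ q) ≫ g' i) := by
  have insert_U (j : ι) : T (f j ≫ (q ≫ p) ≫ g j) =
      ∑ i, T ((f j ≫ q ≫ g' i) ≫ (f' i ≫ p ≫ g j)) := by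
    conv_lhs => rw [← Category.id_comp p, h']
    simp [Preadditive.sum_comp, Preadditive.comp_sum]
  have insert_V (i : κ) : T (f' i ≫ (p ≫ q) ≫ g' i) =
      ∑ j, T ((f' i ≫ p ≫ g j) ≫ (f j ≫ q ≫ g' i)) := by
    conv_lhs => rw [← Category.id_comp q, h]
    simp [Preadditive.sum_comp, Preadditive.comp_sum]
  simp only [insert_U, insert_V, hT (f _ ≫ _)]
  exact Finset.sum_comm

variable {I : ObjectProperty C}

/-- The extension of a linear form on the endomorphisms of a generator of `I` to a family of linear
forms on `I`. It depends on the chosen decompositions of the identities, unless the form is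
cyclic. -/
noncomputable def extendTrace (hG : IsIdealGenerator I G) (T : (G ⟶ G) →ₗ[k] k) :
    TraceFamily k I := fun V hV =>
  ∑ j, T ∘ₗ Linear.leftComp k G ((hG.2 V hV).choose_spec.choose j) ∘ₗ
    Linear.rightComp k V ((hG.2 V hV).choose_spec.choose_spec.choose j)

theorem extendTrace_eq_sum (hG : IsIdealGenerator I G)
    (hT : ∀ a b : G ⟶ G, T (a ≫ b) = T (b ≫ a)) {V : C} (hV : I V)
    {f : ι → (G ⟶ V)} {g : ι → (V ⟶ G)} (h : 𝟙 V = ∑ j, g j ≫ f j) (φ : V ⟶ V) :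
    extendTrace hG T V hV φ = ∑ j, T (f j ≫ φ ≫ g j) := by
  have independence := sum_cyclic_eq_sum_cyclic hT
    (hG.2 V hV).choose_spec.choose_spec.choose_spec h φ (𝟙 V)
  rw [Category.comp_id, Category.id_comp] at independence
  rw [← independence, extendTrace, LinearMap.sum_apply]
  rfl

theorem extendTrace_generator (hG : IsIdealGenerator I G)
    (hT : ∀ a b : G ⟶ G, T (a ≫ b) = T (b ≫ a)) (φ : G ⟶ G) :
    extendTrace hG T G hG.1 φ = T φ := by
  rw [extendTrace_eq_sum hG hT hG.1 (ι := Unit) (f := fun _ => 𝟙 G) (g := fun _ => 𝟙 G) (by simp)]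
  simp

theorem extendTrace_isCyclic (hG : IsIdealGenerator I G)
    (hT : ∀ a b : G ⟶ G, T (a ≫ b) = T (b ≫ a)) : (extendTrace hG T).IsCyclic := by
  intro U V hU hV f g
  obtain ⟨n, a, b, h⟩ := hG.2 U hU
  obtain ⟨m, a', b', h'⟩ := hG.2 V hV
  rw [extendTrace_eq_sum hG hT hV h', extendTrace_eq_sum hG hT hU h]
  exact sum_cyclic_eq_sum_cyclic hT h' h f g

end CyclicForms

section PartialTrace

variable {C : Type u} [Category.{v} C] [MonoidalCategory C] (D : PivotalStructure C)

theorem leftPartialTrace_naturality {U U' W : C} (f : W ⊗ U ⟶ W ⊗ U) (a : U' ⟶ U) (b : U ⟶ U') :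
    leftPartialTrace D (W ◁ a ≫ f ≫ W ◁ b) = a ≫ leftPartialTrace D f ≫ b := by
  simp only [leftPartialTrace, MonoidalCategory.whiskerLeft_comp, Category.assoc,
    leftUnitor_inv_naturality_assoc, whisker_exchange_assoc, associator_naturality_right_assoc,
    associator_inv_naturality_right_assoc, leftUnitor_naturality]

variable {k : Type w} [Field k] [Preadditive C] [Linear k C] [MonoidalPreadditive C]
  {I : ObjectProperty C} {G : C} {t : TraceFamily k I}

theorem TraceFamily.IsCyclic.isLeftMTrace (ht : t.IsCyclic) (hG : IsIdealGenerator I G)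
    (hI : ∀ W, I (W ⊗ G))
    (h : ∀ (W : C) (f : W ⊗ G ⟶ W ⊗ G), t (W ⊗ G) (hI W) f = t G hG.1 (leftPartialTrace D f)) :
    t.IsLeftMTrace D where
  cyclic := ht
  left_partial U W hU hWU f := by
    obtain ⟨n, a, b, hU_id⟩ := hG.2 U hU
    calc t (W ⊗ U) hWU f
      _ = ∑ j, t (W ⊗ U) hWU ((f ≫ W ◁ b j) ≫ W ◁ a j) := by
        conv_lhs => rw [← Category.comp_id f, ← MonoidalCategory.whiskerLeft_id, hU_id]
        simp [Preadditive.comp_sum, whiskerLeft_sum]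
      _ = ∑ j, t G hG.1 (a j ≫ leftPartialTrace D f ≫ b j) := by
        refine Finset.sum_congr rfl fun j _ => ?_
        rw [ht _ _ (hI W) hWU, h, leftPartialTrace_naturality]
      _ = ∑ j, t U hU ((leftPartialTrace D f ≫ b j) ≫ a j) :=
        Finset.sum_congr rfl fun j _ => ht _ _ hU hG.1 _ _
      _ = t U hU (leftPartialTrace D f) := by
        conv_rhs => rw [← Category.comp_id (leftPartialTrace D f), hU_id]
        simp [Preadditive.comp_sum]

end PartialTrace

noncomputable section FreeModules

namespace FDMod

variable {k A : Type u} [Field k] [Ring A] [Algebra k A]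

@[simp]
theorem zero_hom {M N : FDMod k A} : Hom.hom (0 : M ⟶ N) = 0 := rfl

@[simp]
theorem sum_hom {M N : FDMod k A} {ι : Type*} (s : Finset ι) (f : ι → (M ⟶ N)) :
    Hom.hom (∑ i ∈ s, f i : M ⟶ N) = ∑ i ∈ s, (f i).hom :=
  map_sum (AddMonoidHom.mk' (fun f : M ⟶ N => f.hom) add_hom) f s

theorem hom_comp_apply {M N P : FDMod k A} (f : M ⟶ N) (g : N ⟶ P) (x : M.V) :
    (f ≫ g).hom x = g.hom (f.hom x) := rfl

theorem ρ_mul_apply (M : FDMod k A) (a b : A) (m : M.V) : M.ρ (a * b) m = M.ρ a (M.ρ b m) :=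
  congr($(map_mul M.ρ a b) m)

theorem ρ_one_apply (M : FDMod k A) (m : M.V) : M.ρ 1 m = m :=
  congr($(map_one M.ρ) m)

theorem hom_ρ_apply {M N : FDMod k A} (f : M ⟶ N) (a : A) (m : M.V) :
    f.hom (M.ρ a m) = N.ρ a (f.hom m) :=
  congr($(f.comm a) m)

/-- The cokernel of a morphism: the quotient of its target by its range. -/
def coker {M N : FDMod k A} (f : M ⟶ N) : FDMod k A where
  V := N.V ⧸ LinearMap.range f.hom
  ρ := AlgHom.ofLinearMap
    { toFun a := (LinearMap.range f.hom).mapQ (LinearMap.range f.hom) (N.ρ a) (by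
        rintro _ ⟨m, rfl⟩
        exact ⟨M.ρ a m, hom_ρ_apply f a m⟩)
      map_add' _ _ := Submodule.linearMap_qext _ (by ext; simp)
      map_smul' _ _ := Submodule.linearMap_qext _ (by ext; simp) }
    (Submodule.linearMap_qext _ (by ext; simp))
    (fun _ _ => Submodule.linearMap_qext _ (by ext; simp))

theorem surjective_of_epi {M N : FDMod k A} (f : M ⟶ N) [Epi f] : Function.Surjective f.hom := by
  let π : N ⟶ coker f := ⟨(LinearMap.range f.hom).mkQ, fun _ => rfl⟩
  have hπ : π = 0 := by
    rw [← cancel_epi f]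
    exact hom_ext (LinearMap.ext fun x => (Submodule.Quotient.mk_eq_zero _).2 ⟨x, rfl⟩)
  exact fun y => (Submodule.Quotient.mk_eq_zero _).1 congr(Hom.hom $hπ y)

theorem epi_of_surjective {M N : FDMod k A} (f : M ⟶ N) (hf : Function.Surjective f.hom) :
    Epi f where
  left_cancellation u v h := hom_ext <| LinearMap.ext fun y => by
    obtain ⟨x, rfl⟩ := hf y
    exact congr(Hom.hom $h x)

theorem injective_of_comp_eq_id {M N : FDMod k A} {f : M ⟶ N} {s : N.V →ₗ[k] M.V}
    (h : f.hom ∘ₗ s = LinearMap.id) (hd : Module.finrank k M.V = Module.finrank k N.V) :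
    Function.Injective f.hom :=
  (LinearMap.injective_iff_surjective_of_finrank_eq_finrank hd).2
    (LinearMap.surjective_of_comp_eq_id _ _ h)

/-- A morphism between modules of the same dimension that has a linear right inverse is an
isomorphism. -/
def isoOfRightInverse {M N : FDMod k A} (f : M ⟶ N) (s : N.V →ₗ[k] M.V)
    (h : f.hom ∘ₗ s = LinearMap.id) (hd : Module.finrank k M.V = Module.finrank k N.V) :
    M ≅ N where
  hom := f
  inv :=
    { hom := s
      comm a := LinearMap.ext fun x => injective_of_comp_eq_id h hd <| by
        have hs (y : N.V) : f.hom (s y) = y := congr($h y)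
        simp only [LinearMap.comp_apply, hom_ρ_apply, hs] }
  hom_inv_id := hom_ext <| LinearMap.ext fun x =>
    injective_of_comp_eq_id h hd congr($h (f.hom x))
  inv_hom_id := hom_ext h

variable [Module.Finite k A]

theorem ofElem_apply (M : FDMod k A) (m : M.V) (a : A) : (ofElem M m).hom a = M.ρ a m := rfl

theorem regular_hom_ext {M : FDMod k A} {f h : regular k A ⟶ M}
    (e : f.hom (1 : A) = h.hom (1 : A)) : f = h := by
  refine hom_ext (LinearMap.ext fun (a : A) => ?_)
  have ha : (regular k A).ρ a (1 : A) = a := mul_one a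
  rw [← ha, hom_ρ_apply, hom_ρ_apply, e]

instance regular_projective : Projective (regular k A) where
  factors f e _ := by
    obtain ⟨y, hy⟩ := surjective_of_epi e (f.hom (1 : A))
    refine ⟨ofElem _ y, regular_hom_ext ?_⟩
    rw [hom_comp_apply, ofElem_apply, ρ_one_apply, hy]

variable (k A) in
/-- The free module `A ⊗ V` on a vector space `V`. -/
abbrev free (V : Type u) [AddCommGroup V] [Module k V] [Module.Finite k V] : FDMod k A where
  V := A ⊗[k] V
  ρ := AlgHom.ofLinearMap (LinearMap.rTensorHom V ∘ₗ (Algebra.lmul k A).toLinearMap)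
    (by ext; simp) (fun a b => by ext; simp [mul_assoc])

variable {V : Type u} [AddCommGroup V] [Module k V] [Module.Finite k V]

/-- The extension of a linear map to a morphism from the free module. -/
def freeLift {M : FDMod k A} (φ : V →ₗ[k] M.V) : free k A V ⟶ M where
  hom := TensorProduct.lift (LinearMap.lcomp k M.V φ ∘ₗ M.ρ.toLinearMap)
  comm a := TensorProduct.ext' fun (b : A) v => ρ_mul_apply M a b (φ v)

theorem freeLift_tmul {M : FDMod k A} (φ : V →ₗ[k] M.V) (a : A) (v : V) :
    (freeLift φ).hom (a ⊗ₜ[k] v) = M.ρ a (φ v) := rfl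

/-- The morphism `a ↦ a ⊗ v` from the regular module to a free module. -/
def freeIncl (v : V) : regular k A ⟶ free k A V := ofElem (free k A V) ((1 : A) ⊗ₜ[k] v)

theorem freeIncl_apply (v : V) (a : A) : (freeIncl v).hom a = a ⊗ₜ[k] v := by
  change (a * 1) ⊗ₜ[k] v = _
  rw [mul_one]

theorem freeIncl_comp_freeLift {M : FDMod k A} (φ : V →ₗ[k] M.V) (v : V) :
    freeIncl v ≫ freeLift φ = ofElem M (φ v) :=
  hom_ext <| LinearMap.ext fun (a : A) => by
    rw [hom_comp_apply, freeIncl_apply, freeLift_tmul, ofElem_apply]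

/-- The morphism `a ⊗ v ↦ φ(v) a` from a free module to the regular module. -/
def freeCoord (φ : V →ₗ[k] k) : free k A V ⟶ regular k A where
  hom := (TensorProduct.rid k A).toLinearMap ∘ₗ φ.lTensor A
  comm a := TensorProduct.ext' fun (b : A) v => (mul_smul_comm (φ v) a b).symm

theorem freeCoord_tmul (φ : V →ₗ[k] k) (a : A) (v : V) :
    (freeCoord φ).hom (a ⊗ₜ[k] v) = φ v • a := rfl

theorem freeCoord_comp_freeIncl_tmul (φ : V →ₗ[k] k) (w : V) (a : A) (v : V) :
    (freeCoord φ ≫ freeIncl w).hom (a ⊗ₜ[k] v) = a ⊗ₜ[k] (φ v • w) := by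
  rw [hom_comp_apply, freeCoord_tmul, freeIncl_apply]
  exact TensorProduct.smul_tmul _ _ _

variable {ι : Type*} (b : Module.Basis ι k V)

theorem freeIncl_comp_freeCoord [DecidableEq ι] (i j : ι) :
    freeIncl (A := A) (b i) ≫ freeCoord (b.coord j) = if i = j then 𝟙 _ else 0 := by
  refine regular_hom_ext ?_
  rw [hom_comp_apply, freeIncl_apply, freeCoord_tmul]
  split_ifs with hij <;> simp [hij]

variable [Fintype ι]

theorem id_free_eq_sum : 𝟙 (free k A V) = ∑ i, freeCoord (b.coord i) ≫ freeIncl (b i) := by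
  refine hom_ext (TensorProduct.ext' fun (a : A) v => ?_)
  rw [sum_hom, LinearMap.sum_apply,
    Finset.sum_congr rfl fun i _ => freeCoord_comp_freeIncl_tmul (b.coord i) (b i) a v,
    ← TensorProduct.tmul_sum]
  exact congr(a ⊗ₜ[k] $(b.sum_repr v)).symm

theorem id_eq_sum_of_iso_free {M : FDMod k A} (e : free k A V ≅ M) :
    𝟙 M = ∑ i, (e.inv ≫ freeCoord (b.coord i)) ≫ freeIncl (b i) ≫ e.hom := by
  calc 𝟙 M = e.inv ≫ 𝟙 _ ≫ e.hom := by simp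
    _ = _ := by rw [id_free_eq_sum b]; simp [Preadditive.sum_comp, Preadditive.comp_sum]

theorem projective_of_iso_free {M : FDMod k A} (e : free k A V ≅ M) : Projective M :=
  projective_of_id_eq_sum _ _ (id_eq_sum_of_iso_free (Module.finBasis k V) e)

theorem exists_id_eq_sum_of_projective (P : FDMod k A) [Projective P] :
    ∃ (n : ℕ) (f : Fin n → (regular k A ⟶ P)) (g : Fin n → (P ⟶ regular k A)),
      𝟙 P = ∑ j, g j ≫ f j := by
  let π : free k A P.V ⟶ P := freeLift LinearMap.id
  have : Epi π := epi_of_surjective π fun x => ⟨(1 : A) ⊗ₜ[k] x, ρ_one_apply P x⟩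
  let s : P ⟶ free k A P.V := Projective.factorThru (𝟙 P) π
  let b := Module.finBasis k P.V
  refine ⟨_, fun i => freeIncl (b i) ≫ π, fun i => s ≫ freeCoord (b.coord i), ?_⟩
  calc 𝟙 P = s ≫ 𝟙 _ ≫ π := by simp [s]
    _ = _ := by simp [id_free_eq_sum b, Preadditive.sum_comp, Preadditive.comp_sum]

variable (k A) in
theorem regular_isIdealGenerator :
    IsIdealGenerator (isProjective (FDMod k A)) (regular k A) :=
  ⟨regular_projective, fun P (_ : Projective P) => exists_id_eq_sum_of_projective P⟩

end FDMod

end FreeModules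

noncomputable section TensorWithRegular

namespace FDMod

open Coalgebra HopfAlgebra

variable {k A : Type u} [Field k] [Ring A]

instance [Bialgebra k A] : MonoidalPreadditive (FDMod k A) where
  whiskerLeft_zero := hom_ext (TensorProduct.map_zero_right _)
  zero_whiskerRight := hom_ext (TensorProduct.map_zero_left _)
  whiskerLeft_add _ _ := hom_ext (TensorProduct.map_add_right _ _ _)
  add_whiskerRight _ _ := hom_ext (TensorProduct.map_add_left _ _ _)

theorem orb_ρ [Bialgebra k A] (M : FDMod k A) (a : A) (m : M.V) :
    M.orb (M.ρ a m) = M.orb m ∘ₗ LinearMap.mulRight k a :=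
  LinearMap.ext fun b => (ρ_mul_apply M b a m).symm

variable [HopfAlgebra k A]

/-- The linear map `a ⊗ m ↦ a₁ ⊗ S(a₂) m`. -/
def regularTensorUntwist (M : FDMod k A) : A ⊗[k] M.V →ₗ[k] A ⊗[k] M.V :=
  (TensorProduct.lift (M.ρ.toLinearMap ∘ₗ antipode k)).lTensor A ∘ₗ
    (TensorProduct.assoc k A A M.V).toLinearMap ∘ₗ comul.rTensor M.V

theorem regularTensorUntwist_tmul (M : FDMod k A) (a : A) (m : M.V) :
    regularTensorUntwist M (a ⊗ₜ[k] m) = ∑ i ∈ (ℛ k a).index,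
      (ℛ k a).left i ⊗ₜ[k] M.ρ (antipode k ((ℛ k a).right i)) m := by
  rw [regularTensorUntwist, LinearMap.comp_apply, LinearMap.comp_apply, LinearMap.rTensor_tmul,
    ← (ℛ k a).eq]
  simp [TensorProduct.sum_tmul]

variable [Module.Finite k A]

/-- The linear map `m ⊗ a ↦ a₂ ⊗ S⁻¹(a₁) m`. -/
def tensorRegularUntwist (M : FDMod k A) : M.V ⊗[k] A →ₗ[k] A ⊗[k] M.V :=
  (TensorProduct.lift (M.ρ.toLinearMap ∘ₗ (antipodeEquiv k A).symm)).lTensor A ∘ₗ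
    (TensorProduct.assoc k A A M.V).toLinearMap ∘ₗ
    ((TensorProduct.comm k A A).toLinearMap ∘ₗ comul).rTensor M.V ∘ₗ
    (TensorProduct.comm k M.V A).toLinearMap

theorem tensorRegularUntwist_tmul (M : FDMod k A) (m : M.V) (a : A) :
    tensorRegularUntwist M (m ⊗ₜ[k] a) = ∑ i ∈ (ℛ k a).index,
      (ℛ k a).right i ⊗ₜ[k] M.ρ ((antipodeEquiv k A).symm ((ℛ k a).left i)) m := by
  simp only [tensorRegularUntwist, LinearMap.comp_apply, LinearEquiv.coe_coe,
    TensorProduct.comm_tmul, LinearMap.rTensor_tmul]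
  rw [← (ℛ k a).eq]
  simp [TensorProduct.sum_tmul]

theorem freeLift_comp_regularTensorUntwist (M : FDMod k A) :
    (freeLift (M := regular k A ⊗ M) (TensorProduct.mk k A M.V 1)).hom ∘ₗ
      regularTensorUntwist M = LinearMap.id := by
  refine TensorProduct.ext' fun a m => ?_
  have act (i) : (regular k A ⊗ M).ρ ((ℛ k a).left i)
      ((1 : A) ⊗ₜ[k] M.ρ (antipode k ((ℛ k a).right i)) m) =
      TensorProduct.map ((regular k A).orb (1 : A)) (M.orb m)
        (comul ((ℛ k a).left i) * ((1 : A) ⊗ₜ[k] antipode k ((ℛ k a).right i))) := by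
    refine (tensor_ρ_tmul (regular k A) M _ _ _).trans ?_
    rw [orb_ρ, ← LinearMap.mulRight_apply k, LinearMap.mulRight_tmul, LinearMap.mulRight_one,
      TensorProduct.map_map, LinearMap.comp_id]
  have key := congr(TensorProduct.map ((regular k A).orb (1 : A)) (M.orb m)
    $(sum_comul_mul_one_tmul_antipode (ℛ k a)))
  rw [map_sum, TensorProduct.map_tmul, orb_apply, orb_apply, ρ_one_apply] at key
  rw [LinearMap.comp_apply, regularTensorUntwist_tmul, map_sum]
  refine (Finset.sum_congr rfl fun i _ => act i).trans (key.trans ?_)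
  exact congr($(mul_one a) ⊗ₜ[k] m)

theorem freeLift_comp_tensorRegularUntwist (M : FDMod k A) :
    (freeLift (M := M ⊗ regular k A) ((TensorProduct.mk k M.V A).flip 1)).hom ∘ₗ
      tensorRegularUntwist M = LinearMap.id := by
  refine TensorProduct.ext' fun m a => ?_
  let S' := (antipodeEquiv k A).symm
  have act (i) : (M ⊗ regular k A).ρ ((ℛ k a).right i)
      (M.ρ (S' ((ℛ k a).left i)) m ⊗ₜ[k] (1 : A)) =
      TensorProduct.map (M.orb m ∘ₗ S') ((regular k A).orb (1 : A))
        (((ℛ k a).left i ⊗ₜ[k] (1 : A)) *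
          TensorProduct.map (antipode k) LinearMap.id (comul ((ℛ k a).right i))) := by
    refine (tensor_ρ_tmul M (regular k A) _ _ _).trans ?_
    rw [orb_ρ, ← LinearMap.mulLeft_apply k, LinearMap.mulLeft_tmul, LinearMap.mulLeft_one,
      TensorProduct.map_map, TensorProduct.map_map]
    congr 2
    ext b
    simp [S', antipodeEquiv_symm_mul]
  have key := congr(TensorProduct.map (M.orb m ∘ₗ S') ((regular k A).orb (1 : A))
    $(sum_tmul_one_mul_antipode_map_comul (ℛ k a)))
  rw [map_sum, TensorProduct.map_tmul] at key
  have hS' : S' 1 = 1 := by simpa using antipodeEquiv_symm_antipode (k := k) (1 : A)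
  rw [LinearMap.comp_apply, tensorRegularUntwist_tmul, map_sum]
  refine (Finset.sum_congr rfl fun i _ => act i).trans (key.trans ?_)
  rw [LinearMap.comp_apply, LinearEquiv.coe_coe, hS', orb_apply, ρ_one_apply]
  exact congr(m ⊗ₜ[k] $(mul_one a))

/-- The isomorphism `a ⊗ m ↦ a (1 ⊗ m)` from a free module to `A ⊗ M`. -/
def regularTensorIso (M : FDMod k A) : free k A M.V ≅ regular k A ⊗ M :=
  isoOfRightInverse (freeLift (M := regular k A ⊗ M) (TensorProduct.mk k A M.V 1))
    (regularTensorUntwist M) (freeLift_comp_regularTensorUntwist M) rfl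

/-- The isomorphism `a ⊗ m ↦ a (m ⊗ 1)` from a free module to `M ⊗ A`. -/
def tensorRegularIso (M : FDMod k A) : free k A M.V ≅ M ⊗ regular k A :=
  isoOfRightInverse (freeLift (M := M ⊗ regular k A) ((TensorProduct.mk k M.V A).flip 1))
    (tensorRegularUntwist M) (freeLift_comp_tensorRegularUntwist M)
    (TensorProduct.comm k A M.V).finrank_eq

theorem freeIncl_comp_regularTensorIso_hom (M : FDMod k A) (m : M.V) :
    freeIncl m ≫ (regularTensorIso M).hom = ofElem (regular k A ⊗ M) ((1 : A) ⊗ₜ[k] m) :=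
  freeIncl_comp_freeLift (M := regular k A ⊗ M) _ m

theorem freeIncl_comp_tensorRegularIso_hom (M : FDMod k A) (m : M.V) :
    freeIncl m ≫ (tensorRegularIso M).hom = ofElem (M ⊗ regular k A) (m ⊗ₜ[k] (1 : A)) :=
  freeIncl_comp_freeLift (M := M ⊗ regular k A) _ m

theorem isTensorIdeal_isProjective : IsTensorIdeal (isProjective (FDMod k A)) where
  tensor_right V W (hV : Projective V) := by
    obtain ⟨n, f, h, e⟩ := exists_id_eq_sum_of_projective V
    have : Projective (regular k A ⊗ W) := projective_of_iso_free (regularTensorIso W)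
    refine projective_of_id_eq_sum (fun j => f j ▷ W) (fun j => h j ▷ W) ?_
    rw [← id_whiskerRight, e, sum_whiskerRight]
    simp
  tensor_left V W (hV : Projective V) := by
    obtain ⟨n, f, h, e⟩ := exists_id_eq_sum_of_projective V
    have : Projective (W ⊗ regular k A) := projective_of_iso_free (tensorRegularIso W)
    refine projective_of_id_eq_sum (fun j => W ◁ f j) (fun j => W ◁ h j) ?_
    rw [← whiskerLeft_id, e, whiskerLeft_sum]
    simp
  retract V W f h e (hV : Projective V) :=
    (CategoryTheory.Retract.mk f h e).projective

end FDMod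

end TensorWithRegular

noncomputable section LeftTrace

open Coalgebra HopfAlgebra

theorem trace_eq_sum_coord {ι R M : Type*} [CommRing R] [AddCommGroup M] [Module R M] [Fintype ι]
    (b : Module.Basis ι R M) (f : M →ₗ[R] M) :
    LinearMap.trace R M f = ∑ i, b.coord i (f (b i)) := by
  classical
  rw [LinearMap.trace_eq_matrix_trace R b, Matrix.trace]
  simp [LinearMap.toMatrix_apply]

namespace FDMod

variable {k A : Type u} [Field k] [Ring A]

section Algebra

variable [Algebra k A] [Module.Finite k A]

/-- The linear form `f ↦ τ(f(1))` on the endomorphisms of the regular module. -/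
def regularForm (τ : A →ₗ[k] k) : (regular k A ⟶ regular k A) →ₗ[k] k where
  toFun f := τ (f.hom (1 : A))
  map_add' _ _ := map_add τ _ _
  map_smul' _ _ := map_smul τ _ _

theorem regularForm_apply (τ : A →ₗ[k] k) (f : regular k A ⟶ regular k A) :
    regularForm τ f = τ (f.hom (1 : A)) := rfl

theorem regular_comp_hom_one (f h : regular k A ⟶ regular k A) :
    (f ≫ h).hom (1 : A) = (f.hom (1 : A) : A) * (h.hom (1 : A) : A) := by
  have hf : (regular k A).ρ (f.hom (1 : A)) (1 : A) = f.hom (1 : A) := mul_one (M := A) _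
  rw [hom_comp_apply, ← hf, hom_ρ_apply, hf]
  rfl

theorem regularForm_comm {τ : A →ₗ[k] k} (hτ : ∀ a b, τ (a * b) = τ (b * a))
    (f h : regular k A ⟶ regular k A) : regularForm τ (f ≫ h) = regularForm τ (h ≫ f) := by
  rw [regularForm_apply, regularForm_apply, regular_comp_hom_one, regular_comp_hom_one, hτ]

end Algebra

section Contract

variable {V U : Type u} [AddCommGroup V] [Module k V] [AddCommGroup U] [Module k U]

theorem lid_map_contractLeft_apply (φ : V →ₗ[k] k) (τ : U →ₗ[k] k) (z : V ⊗[k] U) :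
    τ (TensorProduct.lid k U (TensorProduct.map (contractLeft k V) LinearMap.id
      ((TensorProduct.assoc k (Module.Dual k V) V U).symm (φ ⊗ₜ[k] z)))) =
      φ (TensorProduct.rid k V (τ.lTensor V z)) := by
  induction z with
  | zero => simp
  | add x y hx hy => simp only [TensorProduct.tmul_add, map_add, hx, hy]
  | tmul v u => simp [mul_comm]

end Contract

variable [HopfAlgebra k A] [Module.Finite k A]

/-- The endomorphism `w ↦ (id ⊗ τ)(f(w ⊗ 1))` of the space of `W`. -/
def slice (τ : A →ₗ[k] k) {W : FDMod k A} (f : W ⊗ regular k A ⟶ W ⊗ regular k A) :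
    W.V →ₗ[k] W.V :=
  (TensorProduct.rid k W.V).toLinearMap ∘ₗ τ.lTensor W.V ∘ₗ f.hom ∘ₗ
    (TensorProduct.mk k W.V A).flip 1

theorem regularForm_leftPartialTrace (g : Pivot k A) (τ : A →ₗ[k] k) {W : FDMod k A}
    (f : W ⊗ regular k A ⟶ W ⊗ regular k A) :
    regularForm τ (leftPartialTrace (pivotal g) f) =
      LinearMap.trace k W.V (slice τ f ∘ₗ W.ρ ((g.val⁻¹ : Aˣ) : A)) := by
  change τ (TensorProduct.lid k A (TensorProduct.map (contractLeft k W.V) LinearMap.id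
    ((TensorProduct.assoc k (Module.Dual k W.V) W.V A).symm
      (TensorProduct.map LinearMap.id f.hom (TensorProduct.assoc k (Module.Dual k W.V) W.V A
        ((TensorProduct.comm k W.V (Module.Dual k W.V)
        (TensorProduct.map (W.ρ ((g.val⁻¹ : Aˣ) : A)) LinearMap.id
          (coevaluation k W.V 1))) ⊗ₜ[k] (1 : A))))))) = _
  rw [coevaluation_apply_one, trace_eq_sum_coord (Module.Basis.ofVectorSpace k W.V)]
  simp only [TensorProduct.sum_tmul, map_sum, TensorProduct.assoc_tmul, TensorProduct.comm_tmul,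
    TensorProduct.map_tmul, LinearMap.id_apply]
  exact Finset.sum_congr rfl fun i _ => lid_map_contractLeft_apply _ _ _

theorem freeCoord_tensorRegularUntwist (g : Pivot k A) {τ : A →ₗ[k] k}
    (hτ : ∀ a, ∑ i ∈ (ℛ k a).index, τ ((ℛ k a).right i) • (ℛ k a).left i = τ a • (g.val : A))
    (W : FDMod k A) (φ : W.V →ₗ[k] k) (z : W.V ⊗[k] A) :
    τ ((freeCoord φ).hom (tensorRegularUntwist W z)) =
      φ (W.ρ ((g.val⁻¹ : Aˣ) : A) (TensorProduct.rid k W.V (τ.lTensor W.V z))) := by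
  induction z with
  | zero => simp
  | add x y hx hy => simp only [map_add, hx, hy]
  | tmul w a =>
    have antipode_symm_val : (antipodeEquiv k A).symm (g.val : A) = ((g.val⁻¹ : Aˣ) : A) := by
      rw [← g.antipode_val_inv, antipodeEquiv_symm_antipode]
    have key := congr(φ (W.ρ ((antipodeEquiv k A).symm $(hτ a)) w))
    simp only [map_sum, map_smul, LinearMap.sum_apply, LinearMap.smul_apply,
      antipode_symm_val] at key
    rw [tensorRegularUntwist_tmul, map_sum, map_sum, LinearMap.lTensor_tmul,
      TensorProduct.rid_tmul, map_smul, map_smul, ← key]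
    refine Finset.sum_congr rfl fun i _ => ?_
    rw [freeCoord_tmul, map_smul, smul_eq_mul, smul_eq_mul, mul_comm]

theorem extendTrace_tensor_regular (g : Pivot k A) {τ : A →ₗ[k] k}
    (hτ : ∀ a b, τ (a * b) = τ (b * a))
    (hτg : ∀ a, ∑ i ∈ (ℛ k a).index, τ ((ℛ k a).right i) • (ℛ k a).left i = τ a • (g.val : A))
    {W : FDMod k A} (hW : isProjective (FDMod k A) (W ⊗ regular k A))
    (f : W ⊗ regular k A ⟶ W ⊗ regular k A) :
    extendTrace (regular_isIdealGenerator k A) (regularForm τ) _ hW f =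
      LinearMap.trace k W.V (W.ρ ((g.val⁻¹ : Aˣ) : A) ∘ₗ slice τ f) := by
  let b := Module.finBasis k W.V
  rw [extendTrace_eq_sum _ (regularForm_comm hτ) hW (id_eq_sum_of_iso_free b (tensorRegularIso W)),
    trace_eq_sum_coord b]
  refine Finset.sum_congr rfl fun i _ => ?_
  have incl_one : (freeIncl (b i) ≫ (tensorRegularIso W).hom).hom (1 : A) = b i ⊗ₜ[k] (1 : A) := by
    rw [freeIncl_comp_tensorRegularIso_hom, ofElem_apply, ρ_one_apply]
  rw [regularForm_apply, hom_comp_apply, hom_comp_apply, incl_one]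
  exact freeCoord_tensorRegularUntwist g hτg W (b.coord i) _

theorem extendTrace_isLeftMTrace (g : Pivot k A) {τ : A →ₗ[k] k}
    (hτ : ∀ a b, τ (a * b) = τ (b * a))
    (hτg : ∀ a, ∑ i ∈ (ℛ k a).index, τ ((ℛ k a).right i) • (ℛ k a).left i = τ a • (g.val : A)) :
    (extendTrace (regular_isIdealGenerator k A) (regularForm τ)).IsLeftMTrace (pivotal g) := by
  refine (extendTrace_isCyclic _ (regularForm_comm hτ)).isLeftMTrace _
    (regular_isIdealGenerator k A)
    (fun W => isTensorIdeal_isProjective.tensor_left _ W regular_projective) fun W f => ?_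
  rw [extendTrace_tensor_regular g hτ hτg, extendTrace_generator _ (regularForm_comm hτ),
    regularForm_leftPartialTrace, LinearMap.trace_comp_comm']

end FDMod

end LeftTrace

section Nondegeneracy

namespace TraceFamily.IsCyclic

variable {k : Type w} {C : Type u} [Field k] [Category.{v} C] [MonoidalCategory C] [Preadditive C]
  [Linear k C] {I : ObjectProperty C} {G P : C} {t : TraceFamily k I} {η : 𝟙_ C ⟶ G}
  {ε : G ⟶ 𝟙_ C} {ι : Type*} [Fintype ι] {f : ι → (G ⟶ P)} {g : ι → (P ⟶ G)}

theorem comp_eq_trace_smul_left (ht : t.IsCyclic) (hI : I G) (hn : t G hI (ε ≫ η) = 1)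
    (hη : ∀ x : 𝟙_ C ⟶ G, ∃ r : k, x = r • η) (hP : I P) (x : 𝟙_ C ⟶ P) (q : P ⟶ G) :
    x ≫ q = t P hP ((q ≫ ε) ≫ x) • η := by
  obtain ⟨r, hr⟩ := hη (x ≫ q)
  rw [Category.assoc, ht _ _ hI hP, Category.assoc, hr, Linear.comp_smul, map_smul, hn,
    smul_eq_mul, mul_one]

theorem comp_eq_trace_smul_right (ht : t.IsCyclic) (hI : I G) (hn : t G hI (ε ≫ η) = 1)
    (hε : ∀ y : G ⟶ 𝟙_ C, ∃ r : k, y = r • ε) (hP : I P) (p : G ⟶ P) (y : P ⟶ 𝟙_ C) :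
    p ≫ y = t P hP (y ≫ η ≫ p) • ε := by
  obtain ⟨r, hr⟩ := hε (p ≫ y)
  rw [← Category.assoc, ht _ _ hI hP, ← Category.assoc, hr, Linear.smul_comp, map_smul, hn,
    smul_eq_mul, mul_one]

theorem eq_of_forall_trace_left_eq (ht : t.IsCyclic) (hI : I G) (hn : t G hI (ε ≫ η) = 1)
    (hη : ∀ x : 𝟙_ C ⟶ G, ∃ r : k, x = r • η) (hP : I P) (h : 𝟙 P = ∑ j, g j ≫ f j)
    {x x' : 𝟙_ C ⟶ P} (hx : ∀ j, t P hP ((g j ≫ ε) ≫ x) = t P hP ((g j ≫ ε) ≫ x')) : x = x' := by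
  rw [← Category.comp_id x, ← Category.comp_id x', h, Preadditive.comp_sum, Preadditive.comp_sum]
  refine Finset.sum_congr rfl fun j _ => ?_
  simp only [← Category.assoc _ (g j), ht.comp_eq_trace_smul_left hI hn hη hP, hx]

theorem eq_of_forall_trace_right_eq (ht : t.IsCyclic) (hI : I G) (hn : t G hI (ε ≫ η) = 1)
    (hε : ∀ y : G ⟶ 𝟙_ C, ∃ r : k, y = r • ε) (hP : I P) (h : 𝟙 P = ∑ j, g j ≫ f j)
    {y y' : P ⟶ 𝟙_ C} (hy : ∀ j, t P hP (y ≫ η ≫ f j) = t P hP (y' ≫ η ≫ f j)) : y = y' := by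
  rw [← Category.id_comp y, ← Category.id_comp y', h, Preadditive.sum_comp, Preadditive.sum_comp]
  refine Finset.sum_congr rfl fun j _ => ?_
  simp only [Category.assoc, ht.comp_eq_trace_smul_right hI hn hε hP, hy]

theorem isNondegenerate (ht : t.IsCyclic) (hG : IsIdealGenerator I G)
    (hn : t G hG.1 (ε ≫ η) = 1) (hη : ∀ x : 𝟙_ C ⟶ G, ∃ r : k, x = r • η)
    (hε : ∀ y : G ⟶ 𝟙_ C, ∃ r : k, y = r • ε) : t.IsNondegenerate := by
  intro P hP
  obtain ⟨n, f, g, h⟩ := hG.2 P hP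
  refine ⟨fun x hx => ?_, fun y hy => ?_⟩
  · exact ht.eq_of_forall_trace_left_eq hG.1 hn hη hP h fun _ => by
      rw [hx, Limits.comp_zero, map_zero]
  · exact ht.eq_of_forall_trace_right_eq hG.1 hn hε hP h fun _ => by
      rw [hy, Limits.zero_comp, map_zero]

theorem isDualBasisSum (ht : t.IsCyclic) (hI : I G) (hn : t G hI (ε ≫ η) = 1)
    (hη : ∀ x : 𝟙_ C ⟶ G, ∃ r : k, x = r • η) (hε : ∀ y : G ⟶ 𝟙_ C, ∃ r : k, y = r • ε)
    (hP : I P) {n : ℕ} {f : Fin n → (G ⟶ P)} {g : Fin n → (P ⟶ G)} (h : 𝟙 P = ∑ j, g j ≫ f j)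
    (hfg : ∀ i j, f i ≫ g j = if i = j then 𝟙 G else 0) :
    t.IsDualBasisSum P hP (∑ i, (g i ≫ ε) ≫ η ≫ f i) := by
  have orthonormal (i j) : t P hP ((g j ≫ ε) ≫ η ≫ f i) = if i = j then 1 else 0 := by
    have rotate : t P hP ((g j ≫ ε) ≫ η ≫ f i) = t G hI ((ε ≫ η) ≫ f i ≫ g j) := by
      simpa using ht _ _ hI hP (g j) (ε ≫ η ≫ f i)
    rw [rotate, hfg]
    split_ifs <;> simp [hn]
  have basis_x : Module.DualBases (fun i => η ≫ f i)
      (fun j => t P hP ∘ₗ Linear.leftComp k P (g j ≫ ε)) :=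
    { eval_same i := (orthonormal i i).trans (if_pos rfl)
      eval_of_ne i j hij := (orthonormal j i).trans (if_neg hij.symm)
      total := ht.eq_of_forall_trace_left_eq hI hn hη hP h }
  have basis_y : Module.DualBases (fun j => g j ≫ ε)
      (fun i => t P hP ∘ₗ Linear.rightComp k P (η ≫ f i)) :=
    { eval_same i := (orthonormal i i).trans (if_pos rfl)
      eval_of_ne i j hij := (orthonormal i j).trans (if_neg hij)
      total := ht.eq_of_forall_trace_right_eq hI hn hε hP h }
  refine ⟨n, basis_x.basis, basis_y.basis, ?_, ?_⟩ <;>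
  simp only [Module.DualBases.coe_basis, orthonormal, implies_true]

end TraceFamily.IsCyclic

end Nondegeneracy

noncomputable section Chromatic

open Coalgebra HopfAlgebra

variable {k A : Type u} [Field k] [Ring A] [HopfAlgebra k A]

namespace FDMod

section DualBasisSum

variable [Module.Finite k A] {l : A →ₗ[k] k} {c : A}

theorem eq_smul_counitHom (y : regular k A ⟶ 𝟙_ (FDMod k A)) :
    y = (y.hom (1 : A) : k) • counitHom k A := by
  refine regular_hom_ext ?_
  change (_ : k) = (y.hom (1 : A) : k) * counit (R := k) (1 : A)
  rw [Bialgebra.counit_one, mul_one]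

theorem eq_smul_cointegralHom (h : IsIntegralPair l c) (x : 𝟙_ (FDMod k A) ⟶ regular k A) :
    x = l (x.hom (1 : k)) • cointegralHom c h.isLeftCointegral := by
  have hx : IsLeftCointegral k (x.hom (1 : k) : A) := fun a => by
    refine (hom_ρ_apply x a (1 : k)).symm.trans ?_
    rw [← map_smul]
    rfl
  refine hom_ext (LinearMap.ext_ring ?_)
  refine (h.eq_smul_of_isLeftCointegral hx).trans ?_
  exact congr(l (x.hom (1 : k)) • $((one_smul k c).symm))

theorem counit_freeCoord_regularTensorUntwist (M : FDMod k A) (φ : M.V →ₗ[k] k) (a : A)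
    (m : M.V) :
    counit (R := k) ((freeCoord φ).hom (regularTensorUntwist M (a ⊗ₜ[k] m)) : A) =
      φ (M.ρ (antipode k a) m) := by
  have key := congr(φ (M.ρ (antipode k $(sum_counit_smul (ℛ k a))) m))
  simp only [map_sum, map_smul, LinearMap.sum_apply, LinearMap.smul_apply] at key
  rw [regularTensorUntwist_tmul, map_sum, map_sum, ← key]
  refine Finset.sum_congr rfl fun i _ => ?_
  rw [freeCoord_tmul, map_smul, smul_eq_mul, smul_eq_mul, mul_comm]

theorem sum_coord_counitHom_cointegralHom_apply (hc : IsLeftCointegral k c) (M : FDMod k A)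
    {ι : Type*} [Fintype ι] (b : Module.Basis ι k M.V) (a : A) (m : M.V) :
    (∑ i, (((regularTensorIso M).inv ≫ freeCoord (b.coord i)) ≫ counitHom k A) ≫
      cointegralHom c hc ≫ freeIncl (b i) ≫ (regularTensorIso M).hom :
        regular k A ⊗ M ⟶ regular k A ⊗ M).hom (a ⊗ₜ[k] m) =
      (regular k A ⊗ M).ρ c ((1 : A) ⊗ₜ[k] M.ρ (antipode k a) m) := by
  rw [sum_hom, LinearMap.sum_apply]
  refine Eq.trans (Finset.sum_congr rfl fun i _ => ?_) (sum_coord_smul_map b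
    ((regular k A ⊗ M).ρ c ∘ₗ TensorProduct.mk k A M.V 1) (M.ρ (antipode k a) m))
  rw [freeIncl_comp_regularTensorIso_hom]
  refine (map_smul (ofElem (regular k A ⊗ M) ((1 : A) ⊗ₜ[k] b i)).hom _ c).trans ?_
  exact congr($(counit_freeCoord_regularTensorUntwist M (b.coord i) a m) • _)

end DualBasisSum

/-- The linear map `y ↦ l(S(z₁) y) z₂`. -/
def integralContract (l : A →ₗ[k] k) (z : A) : A →ₗ[k] A :=
  ∑ j ∈ (ℛ k z).index,
    (l ∘ₗ LinearMap.mulLeft k (antipode k ((ℛ k z).left j))).smulRight ((ℛ k z).right j)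

theorem trace_mulLeft_comp_integralContract [Module.Finite k A] {l : A →ₗ[k] k} {c : A}
    (h : IsIntegralPair l c) (hA : IsUnimodular k A) (u z : A) :
    LinearMap.trace k A (LinearMap.mulLeft k u ∘ₗ integralContract l z) =
      counit (R := k) z * l u := by
  have mulLeft_comp : LinearMap.mulLeft k u ∘ₗ integralContract l z =
      ∑ j ∈ (ℛ k z).index, (l ∘ₗ LinearMap.mulLeft k (antipode k ((ℛ k z).left j))).smulRight
        (u * (ℛ k z).right j) := by
    ext y
    simp [integralContract]
  have trace_summand (j) : LinearMap.trace k A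
      ((l ∘ₗ LinearMap.mulLeft k (antipode k ((ℛ k z).left j))).smulRight
        (u * (ℛ k z).right j)) =
      l (antipode k ((ℛ k z).left j * antipode k ((ℛ k z).right j)) * u) := by
    rw [LinearMap.trace_smulRight, LinearMap.comp_apply, LinearMap.mulLeft_apply,
      antipode_mul_antidistrib, mul_assoc, h.apply_antipode_antipode_mul hA, mul_assoc]
  rw [mulLeft_comp, map_sum, Finset.sum_congr rfl fun j _ => trace_summand j, ← map_sum,
    ← Finset.sum_mul, ← map_sum, sum_mul_antipode_eq_smul]
  simp

variable (k A) in
/-- The linear map `(p ⊗ φ) ⊗ (q ⊗ r) ↦ φ(q) p ⊗ r`. -/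
def middleContract : (A ⊗[k] Module.Dual k A) ⊗[k] (A ⊗[k] A) →ₗ[k] A ⊗[k] A :=
  ((TensorProduct.lid k A).toLinearMap ∘ₗ (contractLeft k A).rTensor A ∘ₗ
    (TensorProduct.assoc k (Module.Dual k A) A A).symm.toLinearMap).lTensor A ∘ₗ
    (TensorProduct.assoc k A (Module.Dual k A) (A ⊗[k] A)).toLinearMap

theorem middleContract_tmul (p q r : A) (φ : Module.Dual k A) :
    middleContract k A ((p ⊗ₜ[k] φ) ⊗ₜ[k] (q ⊗ₜ[k] r)) = φ q • (p ⊗ₜ[k] r) :=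
  TensorProduct.tmul_smul _ _ _

variable [Module.Finite k A]

theorem integralHom_apply (l : A →ₗ[k] k) (z : A) :
    (integralHom l).hom z = ∑ j ∈ (ℛ k z).index,
      (dual (regular k A)).ρ ((ℛ k z).left j) l ⊗ₜ[k] (ℛ k z).right j := by
  refine (tensor_ρ_repr (dual (regular k A)) (regular k A) _ l (1 : A)).trans ?_
  exact Finset.sum_congr rfl fun j _ => congr(_ ⊗ₜ[k] $(mul_one ((ℛ k z).right j)))

theorem dTilde_apply (g : Pivot k A) (l : A →ₗ[k] k) (y x : A) :
    (dTilde g l).hom (y ⊗ₜ[k] x) = ∑ i ∈ (ℛ k x).index,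
      integralContract l ((ℛ k x).left i) ((g.val : A) * y) ⊗ₜ[k] (ℛ k x).right i := by
  let F : (Module.Dual k A ⊗[k] A) ⊗[k] A →ₗ[k] A ⊗[k] A :=
    (TensorProduct.lid k (A ⊗[k] A)).toLinearMap ∘ₗ
      TensorProduct.map ((evR g (regular k A)).hom) LinearMap.id ∘ₗ
      (TensorProduct.assoc k A (Module.Dual k A) (A ⊗[k] A)).symm.toLinearMap ∘ₗ
      TensorProduct.mk k A _ y ∘ₗ (TensorProduct.assoc k (Module.Dual k A) A A).toLinearMap
  have hF (φ : Module.Dual k A) (p q : A) :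
      F ((φ ⊗ₜ[k] p) ⊗ₜ[k] q) = (φ ((g.val : A) * y) • p) ⊗ₜ[k] q := rfl
  change F (TensorProduct.map (integralHom l).hom LinearMap.id (comul (R := k) x)) = _
  rw [← (ℛ k x).eq, map_sum, map_sum]
  refine Finset.sum_congr rfl fun i _ => ?_
  rw [TensorProduct.map_tmul, integralHom_apply, TensorProduct.sum_tmul, map_sum,
    integralContract, LinearMap.sum_apply, TensorProduct.sum_tmul]
  exact Finset.sum_congr rfl fun j _ => hF _ _ _

theorem chromaticComposite_apply (g : Pivot k A)
    (L : regular k A ⊗ dual (regular k A) ⟶ regular k A ⊗ dual (regular k A))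
    (d : regular k A ⊗ regular k A ⟶ regular k A ⊗ regular k A) (a x : A) :
    (chromaticComposite (pivotal g) L d).hom (a ⊗ₜ[k] x) = ∑ i, middleContract k A
      (L.hom (a ⊗ₜ[k] (Module.Basis.ofVectorSpace k A).coord i) ⊗ₜ[k]
        d.hom ((((g.val⁻¹ : Aˣ) : A) * Module.Basis.ofVectorSpace k A i) ⊗ₜ[k] x)) := by
  change middleContract k A (TensorProduct.map L.hom d.hom
    ((TensorProduct.assoc k A (Module.Dual k A) (A ⊗[k] A)).symm (a ⊗ₜ[k]
      (TensorProduct.assoc k (Module.Dual k A) A A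
        ((TensorProduct.comm k A (Module.Dual k A)
          (TensorProduct.map ((regular k A).ρ ((g.val⁻¹ : Aˣ) : A)) LinearMap.id
            (coevaluation k A 1))) ⊗ₜ[k] x))))) = _
  rw [coevaluation_apply_one]
  simp only [TensorProduct.sum_tmul, map_sum, TensorProduct.assoc_tmul, TensorProduct.comm_tmul,
    TensorProduct.map_tmul, LinearMap.id_apply, TensorProduct.tmul_sum,
    TensorProduct.assoc_symm_tmul]
  rfl

theorem sum_middleContract {ι : Type*} [Fintype ι] (b : Module.Basis ι k A) (T : A →ₗ[k] A)
    (p r u v : A) :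
    ∑ i, middleContract k A ((p ⊗ₜ[k] (dual (regular k A)).ρ u ((dual (regular k A)).ρ v
      (b.coord i))) ⊗ₜ[k] (T (b i) ⊗ₜ[k] r)) =
      LinearMap.trace k A (LinearMap.mulLeft k (antipode k v * antipode k u) ∘ₗ T) •
        (p ⊗ₜ[k] r) := by
  rw [trace_eq_sum_coord b, Finset.sum_smul]
  refine Finset.sum_congr rfl fun i _ => (middleContract_tmul _ _ _ _).trans ?_
  simp only [LinearMap.comp_apply, LinearMap.mulLeft_apply, mul_assoc]
  rfl

theorem chromaticComposite_dTilde {l : A →ₗ[k] k} {c : A} (h : IsIntegralPair l c)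
    (g : Pivot k A) (hA : IsUnimodular k A)
    (L : regular k A ⊗ dual (regular k A) ⟶ regular k A ⊗ dual (regular k A))
    (hL : ∀ (a : A) (φ : Module.Dual k A), L.hom (a ⊗ₜ[k] φ) =
      (regular k A ⊗ dual (regular k A)).ρ c
        ((1 : A) ⊗ₜ[k] (dual (regular k A)).ρ (antipode k a) φ)) :
    chromaticComposite (pivotal g) L (dTilde g l) = 𝟙 (regular k A ⊗ regular k A) := by
  refine hom_ext (TensorProduct.ext' fun (a : A) (x : A) => ?_)
  let D := dual (regular k A)
  have hL' (φ : Module.Dual k A) : L.hom (a ⊗ₜ[k] φ) = ∑ m ∈ (ℛ k c).index,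
      (ℛ k c).left m ⊗ₜ[k] D.ρ ((ℛ k c).right m) (D.ρ (antipode k a) φ) := by
    refine (hL a φ).trans ((tensor_ρ_repr (regular k A) D c (1 : A) _).trans ?_)
    exact Finset.sum_congr rfl fun m _ => congr($(mul_one ((ℛ k c).left m)) ⊗ₜ[k] _)
  let b := Module.Basis.ofVectorSpace k A
  have summand (i) : middleContract k A (L.hom (a ⊗ₜ[k] b.coord i) ⊗ₜ[k]
      (dTilde g l).hom ((((g.val⁻¹ : Aˣ) : A) * b i) ⊗ₜ[k] x)) =
      ∑ m ∈ (ℛ k c).index, ∑ n ∈ (ℛ k x).index, middleContract k A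
        (((ℛ k c).left m ⊗ₜ[k] D.ρ ((ℛ k c).right m) (D.ρ (antipode k a) (b.coord i))) ⊗ₜ[k]
          (integralContract l ((ℛ k x).left n) (b i) ⊗ₜ[k] (ℛ k x).right n)) := by
    rw [hL', dTilde_apply, Units.mul_inv_cancel_left]
    simp only [TensorProduct.sum_tmul, TensorProduct.tmul_sum, map_sum]
    exact Finset.sum_comm
  calc (chromaticComposite (pivotal g) L (dTilde g l)).hom (a ⊗ₜ[k] x)
    _ = ∑ m ∈ (ℛ k c).index, ∑ n ∈ (ℛ k x).index, LinearMap.trace k A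
          (LinearMap.mulLeft k (antipode k (antipode k a) * antipode k ((ℛ k c).right m)) ∘ₗ
            integralContract l ((ℛ k x).left n)) • ((ℛ k c).left m ⊗ₜ[k] (ℛ k x).right n) := by
      rw [chromaticComposite_apply, Finset.sum_congr rfl fun i _ => summand i, Finset.sum_comm]
      refine Finset.sum_congr rfl fun m _ => Finset.sum_comm.trans ?_
      exact Finset.sum_congr rfl fun n _ => sum_middleContract b _ _ _ _ _
    _ = (∑ m ∈ (ℛ k c).index, l (antipode k ((ℛ k c).right m) * a) • (ℛ k c).left m) ⊗ₜ[k]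
          ∑ n ∈ (ℛ k x).index, counit (R := k) ((ℛ k x).left n) • (ℛ k x).right n := by
      simp only [trace_mulLeft_comp_integralContract h hA, h.apply_antipode_antipode_mul hA,
        TensorProduct.sum_tmul, TensorProduct.tmul_sum, TensorProduct.smul_tmul_smul, mul_comm]
      exact Finset.sum_comm
    _ = a ⊗ₜ[k] x := by rw [h.sum_smul_left, sum_counit_smul]

theorem isChromatic_dTilde {t : TraceFamily k (isProjective (FDMod k A))} {l : A →ₗ[k] k} {c : A}
    (ht : t.IsCyclic) (h : IsIntegralPair l c) (g : Pivot k A) (hA : IsUnimodular k A)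
    (hP : isProjective (FDMod k A) (regular k A))
    (hn : t (regular k A) hP (counitHom k A ≫ cointegralHom c h.isLeftCointegral) = 1) :
    t.IsChromatic (pivotal g) (dTilde g l) := by
  let e := regularTensorIso (dual (regular k A))
  let b := Module.finBasis k (dual (regular k A)).V
  refine ⟨hP, projective_of_iso_free e, _, ht.isDualBasisSum hP hn
    (fun x => ⟨_, eq_smul_cointegralHom h x⟩) (fun y => ⟨_, eq_smul_counitHom y⟩) _
    (id_eq_sum_of_iso_free b e) fun i j => ?_, chromaticComposite_dTilde h g hA _
    (sum_coord_counitHom_cointegralHom_apply h.isLeftCointegral _ b)⟩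
  exact ((Category.assoc _ _ _).trans congr(freeIncl (b i) ≫ $(e.hom_inv_id_assoc _))).trans
    (freeIncl_comp_freeCoord b i j)

end FDMod

end Chromatic

theorem mainTheorem5 (k A : Type u) [Field k] [Ring A] [HopfAlgebra k A] [Module.Finite k A]
    (g : Pivot k A) (hA : IsUnimodular k A) (hg : IsUnibalanced g) :
    IsTensorIdeal (isProjective (FDMod k A)) ∧
    IsIdealGenerator (isProjective (FDMod k A)) (FDMod.regular k A) ∧
    (∃ (l : A →ₗ[k] k) (c : A), IsRightIntegral l ∧ IsLeftCointegral k c ∧ l c = 1) ∧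
    ∃ hP : isProjective (FDMod k A) (FDMod.regular k A),
      ∀ (l : A →ₗ[k] k) (c : A) (hc : IsLeftCointegral k c), IsRightIntegral l → l c = 1 →
        (∃ t : TraceFamily k (isProjective (FDMod k A)),
          t.IsMTrace (FDMod.pivotal g) ∧ t.IsNondegenerate ∧
            t (FDMod.regular k A) hP (FDMod.counitHom k A ≫ FDMod.cointegralHom c hc) = 1) ∧
        ∀ t : TraceFamily k (isProjective (FDMod k A)),
          t.IsMTrace (FDMod.pivotal g) → t.IsNondegenerate →
            t (FDMod.regular k A) hP (FDMod.counitHom k A ≫ FDMod.cointegralHom c hc) = 1 →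
            t.IsChromatic (FDMod.pivotal g) (FDMod.dTilde g l) := by
  refine ⟨FDMod.isTensorIdeal_isProjective, FDMod.regular_isIdealGenerator k A, ?_,
    FDMod.regular_projective, fun l c hc hl hlc => ?_⟩
  · obtain ⟨l, c, h⟩ := exists_isIntegralPair k A
    exact ⟨l, c, h.isRightIntegral, h.isLeftCointegral, h.apply_eq_one⟩
  have h : IsIntegralPair l c := ⟨hl, hc, hlc⟩
  have hG := FDMod.regular_isIdealGenerator k A
  let τ := symmetrizedIntegral g l
  have hτ (a b : A) : τ (a * b) = τ (b * a) := h.symmetrizedIntegral_mul_comm g hA a b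
  let t := extendTrace hG (FDMod.regularForm τ)
  have left_trace : t.IsLeftMTrace (FDMod.pivotal g) :=
    FDMod.extendTrace_isLeftMTrace g hτ (hl.sum_symmetrizedIntegral_smul g)
  have normalized : t (FDMod.regular k A) FDMod.regular_projective
      (FDMod.counitHom k A ≫ FDMod.cointegralHom c hc) = 1 := by
    rw [extendTrace_generator hG (FDMod.regularForm_comm hτ)]
    change τ (Coalgebra.counit (R := k) (1 : A) • c) = 1
    rw [Bialgebra.counit_one, one_smul, h.symmetrizedIntegral_cointegral g hA]
  have nondegenerate : t.IsNondegenerate := left_trace.cyclic.isNondegenerate hG normalized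
    (fun x => ⟨_, FDMod.eq_smul_cointegralHom h x⟩) (fun y => ⟨_, FDMod.eq_smul_counitHom y⟩)
  exact ⟨⟨t, ⟨left_trace, hg t left_trace⟩, nondegenerate, normalized⟩,
    fun t ht _ hn => FDMod.isChromatic_dTilde ht.1.cyclic h g hA _ hn⟩
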